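/- Let $K$ be a field, $n\ge 1$, and let $Q_n$ be the oriented cycle with vertices $1,\dots,n$ (read modulo $n$) and arrows $x_i\colon i\to i+1$. Let $\Lambda=KQ_n/I$ be a Nakayama algebra of order $n$, where $I$ is the two-sided ideal of the path algebra $KQ_n$ (paths composed from left to right) generated by a finite nonempty set of paths, each of length at least one. For each vertex $i$ let $P_i=e_i\Lambda$ be the corresponding indecomposable projective right $\Lambda$-module and $S_i$ the simple right $\Lambda$-module at $i$. The resolution quiver $R(\Lambda)$ has vertices $1,\dots,n$ and an arrow $i\to j$ exactly when the socle of $P_i$ is isomorphic to $S_{j-1}$; a leaf of $R(\Lambda)$ is a vertex that is not the target of any arrow. Let $v$ be a leaf of $R(\Lambda)$ and let $\Lambda'=\mathrm{End}_\Lambda\bigl(\bigoplus_{i\ne v}P_i\bigr)$; in particular, for $v=n$, $\Lambda'=\mathrm{End}_\Lambda(P_1\oplus\cdots\oplus P_{n-1})$. Then $$\mathrm{gl.dim}\,\Lambda'\ \le\ \mathrm{gl.dim}\,\Lambda\ \le\ \mathrm{gl.dim}\,\Lambda'+2 ,$$ where $\mathrm{gl.dim}$ denotes the supremum (possibly $\infty$)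 of the projective dimensions of right modules. In particular, $\mathrm{gl.dim}\,\Lambda<\infty$ if and only if $\mathrm{gl.dim}\,\Lambda'<\infty$. -/

import Mathlib

/-!
Nakayama algebras `K Q_n / I`, where `Q_n` is the oriented `n`-cycle with vertices `ZMod n`
(so the vertices `1, …, n` are read modulo `n`) and one arrow `x_i : i ⟶ i + 1` for each `i`.
-/

namespace Nakayama

universe u

/-- A path in the oriented cycle `Q_n`. It is determined by its source `i` and its length `l`:
it is `x_i x_{i+1} ⋯ x_{i+l-1}`, and the path of length `0` at `i` is the idempotent `e_i`. -/
@[ext]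
structure CyclePath (n : ℕ) where
  /-- the vertex at which the path starts -/
  src : ZMod n
  /-- the number of arrows of the path -/
  len : ℕ

/-- The vertex at which a path ends. -/
def CyclePath.tgt {n : ℕ} (p : CyclePath n) : ZMod n := p.src + (p.len : ZMod n)

/-- The path algebra `K Q_n`: finite formal linear combinations of paths. -/
def PathAlgebra (K : Type u) [Field K] (n : ℕ) : Type u := CyclePath n →₀ K

namespace PathAlgebra

section

variable (K : Type u) [Field K] {n : ℕ}

noncomputable instance : AddCommGroup (PathAlgebra K n) :=
  inferInstanceAs (AddCommGroup (CyclePath n →₀ K))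

noncomputable instance : Module K (PathAlgebra K n) :=
  inferInstanceAs (Module K (CyclePath n →₀ K))

/-- The path `p` as an element of the path algebra. -/
noncomputable def ofPath (p : CyclePath n) : PathAlgebra K n :=
  (Finsupp.single p 1 : CyclePath n →₀ K)

/-- The product of two paths, written from left to right: the concatenation `p q` if `p` ends
where `q` starts, and zero otherwise. -/
noncomputable def pathMul (p q : CyclePath n) : PathAlgebra K n :=
  open Classical in
  if p.tgt = q.src then ofPath K ⟨p.src, p.len + q.len⟩ else 0

/-- The linear map out of the path algebra with prescribed values on the paths. -/
noncomputable def lift {M : Type*} [AddCommGroup M] [Module K M] (f : CyclePath n → M) :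
    PathAlgebra K n →ₗ[K] M :=
  (Finsupp.lift M K (CyclePath n) f : (CyclePath n →₀ K) →ₗ[K] M)

theorem lift_ofPath {M : Type*} [AddCommGroup M] [Module K M] (f : CyclePath n → M)
    (p : CyclePath n) : lift K f (ofPath K p) = f p := by
  have h : Finsupp.lift M K (CyclePath n) f (Finsupp.single p 1) = f p := by simp
  exact h

/-- Multiplication of the path algebra: the bilinear extension of `pathMul`. -/
noncomputable def mulBilin : PathAlgebra K n →ₗ[K] PathAlgebra K n →ₗ[K] PathAlgebra K n :=
  lift K fun p => lift K fun q => pathMul K p q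

noncomputable instance : Mul (PathAlgebra K n) := ⟨fun a b => mulBilin K a b⟩

/-- The unit is the sum of the idempotents `e_i`. -/
noncomputable instance [NeZero n] : One (PathAlgebra K n) :=
  ⟨∑ i : ZMod n, ofPath K ⟨i, 0⟩⟩

theorem mul_def (a b : PathAlgebra K n) : a * b = mulBilin K a b := rfl

theorem one_def [NeZero n] : (1 : PathAlgebra K n) = ∑ i : ZMod n, ofPath K ⟨i, 0⟩ := rfl

theorem mulBilin_ofPath (p q : CyclePath n) :
    mulBilin K (ofPath K p) (ofPath K q) = pathMul K p q := by
  rw [mulBilin, lift_ofPath, lift_ofPath]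

theorem ofPath_mul_ofPath (p q : CyclePath n) :
    ofPath K p * ofPath K q = pathMul K p q := mulBilin_ofPath K p q

theorem lhom_ext {M : Type*} [AddCommMonoid M] [Module K M] {f g : PathAlgebra K n →ₗ[K] M}
    (h : ∀ p, f (ofPath K p) = g (ofPath K p)) : f = g :=
  Finsupp.lhom_ext' (M := K) (α := CyclePath n) fun p => LinearMap.ext_ring (h p)

theorem assoc_ofPath (p q r : CyclePath n) :
    ofPath K p * ofPath K q * ofPath K r = ofPath K p * (ofPath K q * ofPath K r) := by
  have hz : ∀ a : PathAlgebra K n, 0 * a = 0 := fun a => by simp [mul_def]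
  have hz' : ∀ a : PathAlgebra K n, a * 0 = 0 := fun a => by simp [mul_def]
  rw [ofPath_mul_ofPath, ofPath_mul_ofPath]
  unfold pathMul
  by_cases h1 : p.tgt = q.src <;> by_cases h2 : q.tgt = r.src
  · have h3 : CyclePath.tgt (⟨p.src, p.len + q.len⟩ : CyclePath n) = r.src := by
      rw [← h2]
      simp only [CyclePath.tgt] at h1 ⊢
      rw [← h1]
      push_cast
      ring
    have h4 : p.tgt = CyclePath.src (⟨q.src, q.len + r.len⟩ : CyclePath n) := h1
    simp only [h1, h2, if_true, ofPath_mul_ofPath, pathMul, h3, add_assoc]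
  · have h3 : ¬ CyclePath.tgt (⟨p.src, p.len + q.len⟩ : CyclePath n) = r.src := by
      intro h
      apply h2
      rw [← h]
      simp only [CyclePath.tgt] at h1 ⊢
      rw [← h1]
      push_cast
      ring
    simp only [h1, h2, if_true, if_false, ofPath_mul_ofPath, pathMul, h3, hz']
  · simp only [h1, h2, if_true, if_false, ofPath_mul_ofPath, pathMul, hz]
  · simp only [h1, h2, if_false, hz, hz']

theorem mul_assoc' (a b c : PathAlgebra K n) : a * b * c = a * (b * c) := by
  have h1 : ∀ p q : CyclePath n, mulBilin K (mulBilin K (ofPath K p) (ofPath K q)) =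
      (mulBilin K (ofPath K p)).comp (mulBilin K (ofPath K q)) := fun p q =>
    lhom_ext K fun r => assoc_ofPath K p q r
  have h2 : ∀ p : CyclePath n, ((mulBilin K).flip c).comp (mulBilin K (ofPath K p)) =
      (mulBilin K (ofPath K p)).comp ((mulBilin K).flip c) := fun p =>
    lhom_ext K fun q => LinearMap.congr_fun (h1 p q) c
  have h3 : ((mulBilin K).flip c).comp ((mulBilin K).flip b) =
      (mulBilin K).flip (mulBilin K b c) :=
    lhom_ext K fun p => LinearMap.congr_fun (h2 p) b
  exact LinearMap.congr_fun h3 a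

theorem one_mul' [NeZero n] (a : PathAlgebra K n) : 1 * a = a := by
  have h : mulBilin K (1 : PathAlgebra K n) = LinearMap.id := by
    refine lhom_ext K fun p => ?_
    rw [one_def, map_sum, LinearMap.sum_apply, Finset.sum_eq_single p.src]
    · rw [mulBilin_ofPath]
      simp [pathMul, CyclePath.tgt]
    · intro i _ hi
      rw [mulBilin_ofPath]
      simp [pathMul, CyclePath.tgt, hi]
    · intro h
      exact absurd (Finset.mem_univ _) h
  exact LinearMap.congr_fun h a

theorem mul_one' [NeZero n] (a : PathAlgebra K n) : a * 1 = a := by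
  have h : (mulBilin K).flip (1 : PathAlgebra K n) = LinearMap.id := by
    refine lhom_ext K fun p => ?_
    rw [LinearMap.flip_apply, one_def, map_sum, Finset.sum_eq_single p.tgt]
    · rw [mulBilin_ofPath]
      simp [pathMul]
    · intro i _ hi
      rw [mulBilin_ofPath]
      simp [pathMul, Ne.symm hi]
    · intro h
      exact absurd (Finset.mem_univ _) h
  exact LinearMap.congr_fun h a

noncomputable instance [NeZero n] : Ring (PathAlgebra K n) where
  __ := (inferInstance : AddCommGroup (PathAlgebra K n))
  mul := (· * ·)
  one := 1
  mul_assoc := mul_assoc' K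
  one_mul := one_mul' K
  mul_one := mul_one' K
  zero_mul a := by simp [mul_def]
  mul_zero a := by simp [mul_def]
  left_distrib a b c := by simp [mul_def]
  right_distrib a b c := by simp [mul_def]

noncomputable instance [NeZero n] : Algebra K (PathAlgebra K n) :=
  Algebra.ofModule
    (fun r a b => by
      change mulBilin K (r • a) b = r • mulBilin K a b
      simp)
    (fun r a b => by
      change mulBilin K a (r • b) = r • mulBilin K a b
      simp)

end

end PathAlgebra

section

variable (K : Type u) [Field K] {n : ℕ} [NeZero n] (rels : Finset (CyclePath n))

/-- The two-sided ideal of `K Q_n` generated by the given monomial relations. -/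
noncomputable def relationIdeal : TwoSidedIdeal (PathAlgebra K n) :=
  TwoSidedIdeal.span (PathAlgebra.ofPath K '' (rels : Set (CyclePath n)))

/-- The algebra `Λ = K Q_n / I`, with `I` generated by the monomial relations `rels`. It is a
Nakayama algebra of order `n` when `rels` is nonempty and its members have length at least one. -/
def NakayamaAlgebra : Type u := (relationIdeal K rels).ringCon.Quotient

noncomputable instance : Ring (NakayamaAlgebra K rels) :=
  inferInstanceAs (Ring (relationIdeal K rels).ringCon.Quotient)

noncomputable instance : Algebra K (NakayamaAlgebra K rels) :=
  inferInstanceAs (Algebra K (relationIdeal K rels).ringCon.Quotient)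

/-- The quotient map `K Q_n → Λ`. -/
noncomputable def toNakayama : PathAlgebra K n →+* NakayamaAlgebra K rels :=
  (relationIdeal K rels).ringCon.mk'

/-- The class in `Λ` of a path. -/
noncomputable def pathClass (p : CyclePath n) : NakayamaAlgebra K rels :=
  toNakayama K rels (PathAlgebra.ofPath K p)

/-- The indecomposable projective right module `P_i = e_i Λ`.
Right `Λ`-modules are modules over `Λᵐᵒᵖ`. -/
noncomputable def proj (i : ZMod n) :
    Submodule (NakayamaAlgebra K rels)ᵐᵒᵖ (NakayamaAlgebra K rels) :=
  Submodule.span _ {pathClass K rels ⟨i, 0⟩}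

/-- The simple right module `S_i` at the vertex `i`, as the quotient `e_i Λ / x_i Λ`: it is
one-dimensional, spanned by the class of `e_i`, and every arrow acts on it as zero. -/
abbrev SimpleAt (i : ZMod n) : Type u :=
  proj K rels i ⧸
    (Submodule.span (NakayamaAlgebra K rels)ᵐᵒᵖ {pathClass K rels ⟨i, 1⟩}).submoduleOf
      (proj K rels i)

/-- The socle of a module: the sum of its simple submodules. -/
def socle (R M : Type*) [Ring R] [AddCommGroup M] [Module R M] : Submodule R M :=
  sSup {N : Submodule R M | IsSimpleModule R N}

/-- The resolution quiver `R(Λ)`: it has the vertices of `Q_n`, and an arrow `i → j` exactly when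
`P_i` has socle `S_{j-1}`. -/
def resolutionQuiver : Digraph (ZMod n) where
  Adj i j := Nonempty
    (socle (NakayamaAlgebra K rels)ᵐᵒᵖ (proj K rels i) ≃ₗ[(NakayamaAlgebra K rels)ᵐᵒᵖ]
      SimpleAt K rels (j - 1))

/-- A leaf of `R(Λ)`: a vertex that is not the target of any arrow. -/
def IsLeaf (v : ZMod n) : Prop := ∀ i, ¬ (resolutionQuiver K rels).Adj i v

/-- `Λ' = End_Λ(P')`, where `P'` is the direct sum of the projective modules `P_i`, `i ≠ v`
(a direct sum of finitely many modules, hence realized as their product). The multiplication is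
composition of endomorphisms. -/
abbrev ReducedAlgebra (v : ZMod n) : Type u :=
  Module.End (NakayamaAlgebra K rels)ᵐᵒᵖ (∀ i : {i : ZMod n // i ≠ v}, proj K rels i)

end

/-- The (right) global dimension of a ring: the supremum of the projective dimensions of its right
modules. The value is in `{-∞} ∪ ℕ ∪ {∞}`, where `-∞` is taken only by the zero ring. -/
noncomputable def globalDimension (R : Type u) [Ring R] : WithBot ℕ∞ :=
  ⨆ M : ModuleCat.{u} Rᵐᵒᵖ, CategoryTheory.projectiveDimension M

end Nakayama

/-! ### Corner rings and the decomposition of products along `e` and `1 - e` -/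

namespace Nakayama

open CategoryTheory

universe u

/-! Right modules are left modules over the opposite rings `R = Λᵐᵒᵖ` and `S = Λ'ᵐᵒᵖ`. Then `S` is
the corner `e R e` with `e = 1 - e_v`, and the arrow `x : v-1 → v` lies in `(1 - e) R f` with `f =
e_{v-1}`. Every path into `v` from another vertex ends with `x`, so `(1 - e) R e = x f R e`. The
leaf condition says that no nonzero path ending at `v-1` is killed by `x`: if `p` starting at `i`
were, then `P_i` would have socle `S_{v-1}` and `i → v` would be an arrow. As the relations are
monomial, it follows that `x a = 0` forces `f a = 0`. These facts form `CornerData`; the rest of the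
homological argument is about such a corner.

Lower bound. As a right `S`-module, `R e` is `S ⊕ x f S`, hence isomorphic to the projective module
`S ⊕ f S`. So induction `R e ⊗_S N`, realized as `N × f N`, is exact. It is left adjoint to the
exact functor `M ↦ e M`, hence preserves projectives, and it also reflects them. Thus it preserves
projective dimension (`hasProjectiveDimensionLE_ind_iff`).

Upper bound. A module `M` is induced once `x : f M → (1 - e) M` is bijective
(`hasProjectiveDimensionLE_of_bijective`). On a submodule of a free module this map is injective. If
it is injective on `M`, a projective cover of `M` that is minimal at the vertex `v` only has a
kernel on which it is bijective (`hasProjectiveDimensionLE_of_injective`). So every module has a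
second syzygy that is induced, which costs the summand `2`. -/

/-- A ring `S` realized as the corner `e R e` of a ring `R`, where `e = incl 1`, together with an
idempotent `f` of `S` and an element `x ∈ (1 - e) R f` such that left multiplication by `x` is a
bijection from `f R e` onto `(1 - e) R e` and is injective on `f R`. -/
structure CornerData (R S : Type*) [Ring R] [Ring S] where
  incl : S →+ R
  incl_mul : ∀ s t, incl (s * t) = incl s * incl t
  compress : R →+ S
  compress_incl : ∀ s, compress (incl s) = s
  incl_compress : ∀ r, incl (compress r) = incl 1 * r * incl 1
  f : S
  f_mul_f : f * f = f
  x : R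
  one_mul_x : incl 1 * x = 0
  x_mul_f : x * incl f = x
  cancel : ∀ a, x * a = 0 → incl f * a = 0
  exists_mul : ∀ r, ∃ r', (1 - incl 1) * r * incl 1 = x * r'

namespace CornerData

variable {R S : Type u} [Ring R] [Ring S] (D : CornerData R S)

lemma one_mul_incl (s : S) : D.incl 1 * D.incl s = D.incl s := by
  rw [← D.incl_mul, one_mul]

lemma incl_mul_one (s : S) : D.incl s * D.incl 1 = D.incl s := by
  rw [← D.incl_mul, mul_one]

lemma x_mul_one : D.x * D.incl 1 = D.x := by
  rw [← D.x_mul_f, mul_assoc, D.incl_mul_one]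

lemma incl_injective : Function.Injective D.incl :=
  Function.LeftInverse.injective D.compress_incl

lemma cancel_incl {s t : S} (h : D.x * D.incl s = D.x * D.incl t) : D.f * s = D.f * t := by
  apply D.incl_injective
  rw [D.incl_mul, D.incl_mul, ← sub_eq_zero, ← mul_sub]
  apply D.cancel
  rw [mul_sub, h, sub_self]

/-- Replacing the factor `r'` in `(1 - e) r e = x r'` by `f r' e` changes nothing, and this
normalized factor is unique by `cancel`. -/
lemma exists_sigma (r : R) :
    ∃ s, D.f * s = s ∧ D.x * D.incl s = (1 - D.incl 1) * r * D.incl 1 := by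
  obtain ⟨r', hr'⟩ := D.exists_mul r
  refine ⟨D.f * D.compress r', by rw [← mul_assoc, D.f_mul_f], ?_⟩
  rw [D.incl_mul, ← mul_assoc, D.x_mul_f, D.incl_compress, ← mul_assoc, ← mul_assoc, D.x_mul_one,
    ← hr', mul_assoc _ (D.incl 1) (D.incl 1), D.incl_mul_one]

/-- The element `s = f s` of the corner with `x s = (1 - e) r e`. -/
noncomputable def sigma (r : R) : S := (D.exists_sigma r).choose

lemma f_mul_sigma (r : R) : D.f * D.sigma r = D.sigma r := (D.exists_sigma r).choose_spec.1

lemma x_mul_sigma (r : R) : D.x * D.incl (D.sigma r) = (1 - D.incl 1) * r * D.incl 1 :=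
  (D.exists_sigma r).choose_spec.2

lemma eq_sigma {r : R} {s : S} (hs : D.f * s = s)
    (h : D.x * D.incl s = (1 - D.incl 1) * r * D.incl 1) : D.sigma r = s := by
  rw [← hs, ← D.f_mul_sigma]
  exact D.cancel_incl ((D.x_mul_sigma r).trans h.symm)

lemma sigma_add (r r' : R) : D.sigma (r + r') = D.sigma r + D.sigma r' :=
  D.eq_sigma (by simp only [mul_add, f_mul_sigma])
    (by simp only [map_add, mul_add, x_mul_sigma, add_mul])

lemma sigma_zero : D.sigma 0 = 0 := D.eq_sigma (by simp) (by simp)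

lemma sigma_one : D.sigma 1 = 0 :=
  D.eq_sigma (by simp) (by simp [sub_mul, incl_mul_one])

lemma sigma_x : D.sigma D.x = D.f :=
  D.eq_sigma D.f_mul_f (by simp [sub_mul, D.one_mul_x, D.x_mul_one, D.x_mul_f])

lemma compress_one : D.compress 1 = 1 :=
  D.incl_injective (by rw [D.incl_compress, mul_one, D.incl_mul_one])

lemma compress_x : D.compress D.x = 0 :=
  D.incl_injective (by rw [D.incl_compress, D.one_mul_x, zero_mul, map_zero])

lemma incl_compress_mul_x (r : R) : D.incl (D.compress (r * D.x)) = D.incl 1 * r * D.x := by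
  rw [D.incl_compress, mul_assoc, mul_assoc, D.x_mul_one, mul_assoc]

/-- Insert `1 = e + (1 - e)` between the factors of `e r r' e` and write `(1 - e) r' e` as `x` times
`sigma r'`. The same splitting gives `sigma_mul`. -/
lemma compress_mul (r r' : R) :
    D.compress (r * r') = D.compress r * D.compress r' + D.compress (r * D.x) * D.sigma r' := by
  apply D.incl_injective
  rw [map_add, D.incl_mul, D.incl_mul, D.incl_compress_mul_x, mul_assoc, D.x_mul_sigma,
    D.incl_compress, D.incl_compress, D.incl_compress]
  have h := D.incl_mul_one 1
  generalize D.incl 1 = e at *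
  simp only [mul_sub, sub_mul, one_mul, mul_assoc]
  rw [← mul_assoc e e, h]
  abel

lemma x_mul_sigma_mul_x (r : R) : D.x * D.incl (D.sigma (r * D.x)) = (1 - D.incl 1) * r * D.x := by
  rw [D.x_mul_sigma, mul_assoc, mul_assoc, D.x_mul_one, mul_assoc]

lemma sigma_mul (r r' : R) :
    D.sigma (r * r') = D.sigma r * D.compress r' + D.sigma (r * D.x) * D.sigma r' := by
  apply D.eq_sigma
  · rw [mul_add, ← mul_assoc, ← mul_assoc, f_mul_sigma, f_mul_sigma]
  · rw [map_add, mul_add, D.incl_mul, D.incl_mul, ← mul_assoc, ← mul_assoc, x_mul_sigma,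
      x_mul_sigma_mul_x, mul_assoc _ D.x, x_mul_sigma, D.incl_compress]
    have h := D.incl_mul_one 1
    generalize D.incl 1 = e at *
    simp only [mul_sub, sub_mul, one_mul, mul_assoc]
    rw [← mul_assoc e e, h]
    abel

/-! ### Induction from the corner, restriction to it, and projective dimension -/

section Induction

variable (N : Type u) [AddCommGroup N] [Module S N]

/-- The additive group underlying the `R`-module induced from the `S`-module `N`. -/
def Ind : AddSubgroup (N × N) where
  carrier := {p | D.f • p.2 = p.2}
  add_mem' {p q} hp hq := by
    simp only [Set.mem_ofPred_eq] at hp hq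
    simp [hp, hq]
  zero_mem' := by simp
  neg_mem' {p} hp := by
    simp only [Set.mem_ofPred_eq] at hp
    simp [hp]

variable {N}

lemma f_smul_snd (p : D.Ind N) : D.f • p.1.2 = p.1.2 := p.2

/-- The pair `(a, b)` stands for `a + x b`. The two coordinates of `r (a + x b)` are its `e`-part
and the element whose product with `x` is its `(1 - e)`-part. -/
noncomputable instance : SMul R (D.Ind N) where
  smul r p := ⟨(D.compress r • p.1.1 + D.compress (r * D.x) • p.1.2,
    D.sigma r • p.1.1 + D.sigma (r * D.x) • p.1.2), by
      change D.f • (_ + _) = _ + _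
      rw [smul_add, ← mul_smul, ← mul_smul, f_mul_sigma, f_mul_sigma]⟩

lemma ind_smul_fst (r : R) (p : D.Ind N) :
    (r • p).1.1 = D.compress r • p.1.1 + D.compress (r * D.x) • p.1.2 := rfl

lemma ind_smul_snd (r : R) (p : D.Ind N) :
    (r • p).1.2 = D.sigma r • p.1.1 + D.sigma (r * D.x) • p.1.2 := rfl

lemma ind_ext {p q : D.Ind N} (h1 : p.1.1 = q.1.1) (h2 : p.1.2 = q.1.2) : p = q :=
  Subtype.ext (Prod.ext h1 h2)

noncomputable instance : Module R (D.Ind N) where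
  one_smul p := D.ind_ext
    (by rw [ind_smul_fst, one_mul, compress_one, compress_x, one_smul, zero_smul, add_zero])
    (by rw [ind_smul_snd, one_mul, sigma_one, sigma_x, f_smul_snd, zero_smul, zero_add])
  mul_smul r r' p := D.ind_ext
    (by
      rw [ind_smul_fst, mul_assoc, D.compress_mul r r', D.compress_mul r (r' * D.x), ind_smul_fst,
        ind_smul_fst, ind_smul_snd]
      simp only [add_smul, smul_add, mul_smul]
      abel)
    (by
      rw [ind_smul_snd, mul_assoc, D.sigma_mul r r', D.sigma_mul r (r' * D.x), ind_smul_snd,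
        ind_smul_fst, ind_smul_snd]
      simp only [add_smul, smul_add, mul_smul]
      abel)
  smul_zero r := D.ind_ext (by simp [ind_smul_fst]) (by simp [ind_smul_snd])
  zero_smul p := D.ind_ext (by simp [ind_smul_fst]) (by simp [ind_smul_snd, sigma_zero])
  smul_add r p q := D.ind_ext
    (by simp only [ind_smul_fst, AddSubgroup.coe_add, Prod.fst_add, Prod.snd_add, smul_add]; abel)
    (by simp only [ind_smul_snd, AddSubgroup.coe_add, Prod.fst_add, Prod.snd_add, smul_add]; abel)
  add_smul r r' p := D.ind_ext
    (by
      simp only [ind_smul_fst, AddSubgroup.coe_add, Prod.fst_add, add_mul, map_add, add_smul]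
      abel)
    (by
      simp only [ind_smul_snd, AddSubgroup.coe_add, Prod.snd_add, add_mul, sigma_add, add_smul]
      abel)

/-- The map of induced modules given by an `S`-linear map. -/
noncomputable def indMap {N' : Type u} [AddCommGroup N'] [Module S N'] (φ : N →ₗ[S] N') :
    D.Ind N →ₗ[R] D.Ind N' where
  toFun p := ⟨(φ p.1.1, φ p.1.2), by
    change D.f • φ _ = φ _
    rw [← map_smul, f_smul_snd]⟩
  map_add' p q := D.ind_ext (map_add φ _ _) (map_add φ _ _)
  map_smul' r p := D.ind_ext
    (by
      change φ (_ + _) = _ • φ _ + _ • φ _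
      rw [map_add, map_smul, map_smul]
      rfl)
    (by
      change φ (_ + _) = _ • φ _ + _ • φ _
      rw [map_add, map_smul, map_smul]
      rfl)

variable (M : Type u) [AddCommGroup M] [Module R M]

/-- The additive group underlying the `S`-module `e M`. -/
def Res : AddSubgroup M where
  carrier := {m | D.incl 1 • m = m}
  add_mem' {p q} hp hq := by
    simp only [Set.mem_ofPred_eq] at hp hq
    simp [hp, hq]
  zero_mem' := by simp
  neg_mem' {p} hp := by
    simp only [Set.mem_ofPred_eq] at hp
    simp [hp]

variable {M}

lemma one_smul_res (m : D.Res M) : D.incl 1 • m.1 = m.1 := m.2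

lemma smul_mem_res {r : R} (h : D.incl 1 * r = r) (m : M) : r • m ∈ D.Res M := by
  change D.incl 1 • r • m = r • m
  rw [← mul_smul, h]

instance : SMul S (D.Res M) where
  smul s m := ⟨D.incl s • m.1, D.smul_mem_res (D.one_mul_incl s) _⟩

lemma res_smul_coe (s : S) (m : D.Res M) : (s • m).1 = D.incl s • m.1 := rfl

instance : Module S (D.Res M) where
  one_smul m := Subtype.ext (D.one_smul_res m)
  mul_smul s t m := Subtype.ext (by simp only [res_smul_coe, D.incl_mul, mul_smul])
  smul_zero s := Subtype.ext (by simp [res_smul_coe])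
  zero_smul m := Subtype.ext (by simp [res_smul_coe])
  smul_add s p q := Subtype.ext (by simp [res_smul_coe])
  add_smul s t m := Subtype.ext (by simp [res_smul_coe, add_smul])

/-- The restriction of an `R`-linear map to `e M`. -/
def resMap {M' : Type u} [AddCommGroup M'] [Module R M'] (φ : M →ₗ[R] M') :
    D.Res M →ₗ[S] D.Res M' where
  toFun m := ⟨φ m.1, by
    change D.incl 1 • φ _ = φ _
    rw [← map_smul, one_smul_res]⟩
  map_add' p q := Subtype.ext (map_add φ _ _)
  map_smul' r p := Subtype.ext (map_smul φ _ _)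

lemma resMap_surjective {M' : Type u} [AddCommGroup M'] [Module R M'] {φ : M →ₗ[R] M'}
    (h : Function.Surjective φ) : Function.Surjective (D.resMap φ) := by
  intro m
  obtain ⟨p, hp⟩ := h m.1
  refine ⟨⟨D.incl 1 • p, D.smul_mem_res (D.incl_mul_one 1) p⟩, Subtype.ext ?_⟩
  change φ _ = _
  rw [map_smul, hp, one_smul_res]

/-- The `R`-linear map out of an induced module that extends an `S`-linear map `N → e M`. -/
noncomputable def indLift (φ : N →ₗ[S] D.Res M) : D.Ind N →ₗ[R] M where
  toFun p := (φ p.1.1).1 + D.x • (φ p.1.2).1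
  map_add' p q := by
    simp only [AddSubgroup.coe_add, Prod.fst_add, Prod.snd_add, map_add, smul_add]
    abel
  map_smul' r p := by
    rw [ind_smul_fst, ind_smul_snd]
    have h1 : ∀ (a : R) (m : D.Res M), (a * D.incl 1) • m.1 = a • m.1 := fun a m => by
      rw [mul_smul, one_smul_res]
    simp only [map_add, map_smul, AddSubgroup.coe_add, res_smul_coe, RingHom.id_apply, smul_add,
      ← mul_smul, x_mul_sigma, incl_compress, h1]
    simp only [sub_mul, one_mul, sub_smul, mul_smul]
    abel

/-- The element of the induced module given by an element of `N`. -/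
def indMk (n : N) : D.Ind N := ⟨(n, 0), smul_zero D.f⟩

lemma incl_smul_indMk (s : S) (n : N) : D.incl s • D.indMk n = D.indMk (s • n) := by
  have h1 : D.sigma (D.incl s) = 0 := D.eq_sigma (by simp) (by
    rw [sub_mul, one_mul, D.one_mul_incl, sub_self, zero_mul, map_zero, mul_zero])
  refine D.ind_ext ?_ ?_
  · rw [ind_smul_fst, D.compress_incl]
    simp [indMk]
  · rw [ind_smul_snd, h1]
    simp [indMk]

/-- The inclusion of `N` into `e T` for the module `T` induced from `N`. -/
noncomputable def indUnit : N →ₗ[S] D.Res (D.Ind N) where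
  toFun n := ⟨D.indMk n, by
    change D.incl 1 • _ = _
    rw [incl_smul_indMk, one_smul]⟩
  map_add' p q := Subtype.ext (D.ind_ext rfl (add_zero (0 : N)).symm)
  map_smul' s p := Subtype.ext (D.incl_smul_indMk s p).symm

/-- The projection onto the first coordinate, `e T → N`. -/
noncomputable def indFst : D.Res (D.Ind N) →ₗ[S] N where
  toFun p := p.1.1.1
  map_add' _ _ := rfl
  map_smul' s p := by
    have h2 : D.compress (D.incl s * D.x) = 0 := D.incl_injective (by
      rw [D.incl_compress, ← D.incl_mul_one s, mul_assoc (D.incl s), D.one_mul_x, mul_zero,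
        mul_zero, zero_mul, map_zero])
    rw [res_smul_coe, ind_smul_fst, h2, D.compress_incl, zero_smul, add_zero, RingHom.id_apply]

lemma indLift_unit (φ : N →ₗ[S] D.Res M) (n : N) : D.indLift φ (D.indUnit n).1 = (φ n).1 := by
  change (φ n).1 + D.x • (φ 0).1 = _
  simp

/-- The copy of `N` generates: `(a, b) = (a, 0) + x (b, 0)`. -/
lemma ind_hom_ext {φ ψ : D.Ind N →ₗ[R] M} (h : ∀ n, φ (D.indUnit n).1 = ψ (D.indUnit n).1) :
    φ = ψ := by
  refine LinearMap.ext fun p => ?_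
  have hp : p = (D.indUnit p.1.1).1 + D.x • (D.indUnit p.1.2).1 := by
    refine D.ind_ext ?_ ?_
    · change _ = p.1.1 + (D.compress D.x • p.1.2 + _ • (0 : N))
      rw [compress_x]; simp
    · change _ = 0 + (D.sigma D.x • p.1.2 + _ • (0 : N))
      rw [sigma_x, f_smul_snd]; simp
  rw [hp, map_add, map_add, map_smul, map_smul, h, h]

lemma indMap_surjective {N' : Type u} [AddCommGroup N'] [Module S N'] {φ : N →ₗ[S] N'}
    (h : Function.Surjective φ) : Function.Surjective (D.indMap φ) := by
  intro p
  obtain ⟨a, ha⟩ := h p.1.1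
  obtain ⟨b, hb⟩ := h p.1.2
  -- A preimage `b` need not be fixed by `f`; `f b` is, and it has the same image.
  refine ⟨⟨(a, D.f • b), ?_⟩, D.ind_ext ha ?_⟩
  · change D.f • D.f • b = D.f • b
    rw [← mul_smul, D.f_mul_f]
  · change φ (D.f • b) = _
    rw [map_smul, hb, f_smul_snd]

lemma indMap_injective {N' : Type u} [AddCommGroup N'] [Module S N'] {φ : N →ₗ[S] N'}
    (h : Function.Injective φ) : Function.Injective (D.indMap φ) := by
  intro p q hpq
  exact D.ind_ext (h (congrArg (fun z => z.1.1) hpq)) (h (congrArg (fun z => z.1.2) hpq))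

lemma indMap_exact {N₁ N₂ N₃ : Type u} [AddCommGroup N₁] [Module S N₁] [AddCommGroup N₂]
    [Module S N₂] [AddCommGroup N₃] [Module S N₃] {φ : N₁ →ₗ[S] N₂} {ψ : N₂ →ₗ[S] N₃}
    (h : Function.Exact φ ψ) : Function.Exact (D.indMap φ) (D.indMap ψ) := by
  intro p
  constructor
  · intro hp
    obtain ⟨a, ha⟩ := (h p.1.1).1 (congrArg (fun z => z.1.1) hp)
    obtain ⟨b, hb⟩ := (h p.1.2).1 (congrArg (fun z => z.1.2) hp)
    refine ⟨⟨(a, D.f • b), ?_⟩, D.ind_ext ha ?_⟩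
    · change D.f • D.f • b = D.f • b
      rw [← mul_smul, D.f_mul_f]
    · change φ (D.f • b) = _
      rw [map_smul, hb, f_smul_snd]
  · rintro ⟨q, rfl⟩
    exact D.ind_ext (h.apply_apply_eq_zero _) (h.apply_apply_eq_zero _)

/-- A left adjoint of a functor preserving surjections preserves projectives: lift over `e M` and
extend the lift by `indLift`. -/
lemma projective_ind [Module.Projective S N] : Module.Projective R (D.Ind N) := by
  refine Module.Projective.of_lifting_property fun {M} {M'} _ _ _ _ h g hh => ?_
  obtain ⟨φ, hφ⟩ := Module.projective_lifting_property (D.resMap h)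
    ((D.resMap g).comp D.indUnit) (D.resMap_surjective hh)
  refine ⟨D.indLift φ, D.ind_hom_ext fun n => ?_⟩
  rw [LinearMap.comp_apply, indLift_unit]
  exact congrArg Subtype.val (LinearMap.congr_fun hφ n)

/-- Induce the lifting problem, solve it over `R`, and read off the first coordinate; `indFst` is a
retraction of `indUnit`. -/
lemma projective_of_projective_ind [Module.Projective R (D.Ind N)] : Module.Projective S N := by
  refine Module.Projective.of_lifting_property fun {Q} {Q'} _ _ _ _ h g hh => ?_
  obtain ⟨φ, hφ⟩ := Module.projective_lifting_property (D.indMap h) (D.indMap g)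
    (D.indMap_surjective hh)
  refine ⟨D.indFst.comp ((D.resMap φ).comp D.indUnit), LinearMap.ext fun n => ?_⟩
  have h1 := congrArg (fun z => z.1.1) (LinearMap.congr_fun hφ (D.indMk n))
  exact h1

lemma hasProjectiveDimensionLE_ind_succ_iff {N₁ N₂ N₃ : Type u} [AddCommGroup N₁] [Module S N₁]
    [AddCommGroup N₂] [Module S N₂] [AddCommGroup N₃] [Module S N₃] [Module.Projective S N₂]
    {φ : N₁ →ₗ[S] N₂} {ψ : N₂ →ₗ[S] N₃} (h : Function.Exact φ ψ) (hφ : Function.Injective φ)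
    (hψ : Function.Surjective ψ) (d : ℕ) :
    HasProjectiveDimensionLE (ModuleCat.of R (D.Ind N₃)) (d + 1) ↔
      HasProjectiveDimensionLE (ModuleCat.of R (D.Ind N₁)) d := by
  let C := ModuleCat.shortComplexOfCompEqZero (D.indMap φ) (D.indMap ψ)
    (D.indMap_exact h).linearMap_comp_eq_zero
  have hC : C.ShortExact := ModuleCat.shortComplex_shortExact _ (D.indMap_exact h)
    (D.indMap_injective hφ) (D.indMap_surjective hψ)
  exact hC.hasProjectiveDimensionLT_X₃_iff d
    ((IsProjective.iff_projective (R := R) (D.Ind N₂)).1 D.projective_ind)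

/-- Dimension shifting along a free cover of `N`: the induced sequence is again exact with
projective middle term. -/
lemma hasProjectiveDimensionLE_ind_iff (d : ℕ) (N : Type u) [AddCommGroup N] [Module S N] :
    HasProjectiveDimensionLE (ModuleCat.of R (D.Ind N)) d ↔
      HasProjectiveDimensionLE (ModuleCat.of S N) d := by
  induction d generalizing N with
  | zero =>
    rw [← projective_iff_hasProjectiveDimensionLE_zero,
      ← projective_iff_hasProjectiveDimensionLE_zero, ← IsProjective.iff_projective,
      ← IsProjective.iff_projective]
    exact ⟨fun _ => D.projective_of_projective_ind, fun _ => D.projective_ind⟩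
  | succ d ih =>
    let π : (N →₀ S) →ₗ[S] N := Finsupp.linearCombination S id
    have hπ : Function.Surjective π := Finsupp.linearCombination_id_surjective S N
    have h1 := LinearMap.shortExact_shortComplexKer hπ
    have hP : Projective (ModuleCat.of S (N →₀ S)) :=
      (IsProjective.iff_projective _).1 inferInstance
    exact (D.hasProjectiveDimensionLE_ind_succ_iff (N₁ := LinearMap.ker π)
      (φ := (LinearMap.ker π).subtype) (LinearMap.exact_subtype_ker_map π)
      (LinearMap.ker π).injective_subtype hπ d).trans
      ((ih _).trans (h1.hasProjectiveDimensionLT_X₃_iff d hP).symm)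

end Induction

end CornerData

end Nakayama

/-! ### Direct sums of the left ideals generated by idempotents -/

namespace Nakayama

open CategoryTheory

universe u

section IdempotentFamily

variable {R J : Type u} [Ring R]

/-- The direct sum of the left ideals `R u_j`, as a submodule of a free module. -/
def leftIdealSum (u : J → R) : Submodule R (J →₀ R) where
  carrier := {p | ∀ j, p j * u j = p j}
  add_mem' hp hq j := by rw [Finsupp.add_apply, add_mul, hp j, hq j]
  zero_mem' j := by simp
  smul_mem' r p hp j := by rw [Finsupp.smul_apply, smul_eq_mul, mul_assoc, hp j]

variable {u : J → R} (hu : ∀ j, u j * u j = u j)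

lemma linearCombination_single_apply (u : J → R) (p : J →₀ R) (j : J) :
    Finsupp.linearCombination R (fun j => Finsupp.single j (u j)) p j = p j * u j := by
  induction p using Finsupp.induction_linear with
  | zero => simp
  | add p q hp hq => rw [map_add, Finsupp.add_apply, hp, hq, Finsupp.add_apply, add_mul]
  | single i r =>
    rw [Finsupp.linearCombination_single, Finsupp.smul_apply]
    by_cases h : i = j
    · subst h; simp
    · simp [h]

lemma linearCombination_single_eq_self {p : J →₀ R} (hp : p ∈ leftIdealSum u) :
    Finsupp.linearCombination R (fun j => Finsupp.single j (u j)) p = p :=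
  Finsupp.ext fun j => by rw [linearCombination_single_apply, hp j]

include hu in
lemma linearCombination_single_mem (p : J →₀ R) :
    Finsupp.linearCombination R (fun j => Finsupp.single j (u j)) p ∈ leftIdealSum u :=
  fun j => by rw [linearCombination_single_apply, mul_assoc, hu]

include hu in
lemma projective_leftIdealSum : Module.Projective R (leftIdealSum u) :=
  Module.Projective.of_split (leftIdealSum u).subtype
    ((Finsupp.linearCombination R (fun j => Finsupp.single j (u j))).codRestrict _
      (linearCombination_single_mem hu))
    (LinearMap.ext fun p => Subtype.ext (linearCombination_single_eq_self p.2))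

lemma single_mem_leftIdealSum {j : J} {r : R} (h : r * u j = r) :
    Finsupp.single j r ∈ leftIdealSum u := fun i => by
  by_cases hi : j = i
  · subst hi; simpa using h
  · simp [hi]

end IdempotentFamily

/-! ### The upper bound: recognizing induced modules among syzygies -/

namespace CornerData

variable {R S : Type u} [Ring R] [Ring S] (D : CornerData R S)

/-- The two conditions make the counit `Ind (e M) → M`, `(a, b) ↦ a + x b`, an isomorphism, because
`M = e M ⊕ (1 - e) M`. -/
lemma hasProjectiveDimensionLE_of_bijective {M : Type u} [AddCommGroup M] [Module R M] {d : ℕ}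
    (hinj : ∀ m : M, D.incl D.f • m = m → D.x • m = 0 → m = 0)
    (hsurj : ∀ m : M, D.incl 1 • m = 0 → ∃ m', D.incl D.f • m' = m' ∧ D.x • m' = m)
    (hd : HasProjectiveDimensionLE (ModuleCat.of S (D.Res M)) d) :
    HasProjectiveDimensionLE (ModuleCat.of R M) d := by
  have hx : ∀ m : M, D.incl 1 • D.x • m = 0 := fun m => by
    rw [← mul_smul, D.one_mul_x, zero_smul]
  let ε : D.Ind (D.Res M) →ₗ[R] M := D.indLift LinearMap.id
  have hε : ∀ p : D.Ind (D.Res M), ε p = p.1.1.1 + D.x • p.1.2.1 := fun p => rfl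
  have hb : Function.Bijective ε := by
    constructor
    · rw [injective_iff_map_eq_zero]
      intro p hp
      rw [hε] at hp
      have h1 : p.1.1.1 = 0 := by
        have h := congrArg (fun z => D.incl 1 • z) hp
        simpa only [smul_add, hx, one_smul_res, add_zero, smul_zero] using h
      rw [h1, zero_add] at hp
      exact D.ind_ext (Subtype.ext h1)
        (Subtype.ext (hinj _ (congrArg Subtype.val (D.f_smul_snd p)) hp))
    · intro m
      have hm : D.incl 1 • D.incl 1 • m = D.incl 1 • m := by
        rw [← mul_smul, D.incl_mul_one]
      obtain ⟨m', h1, h2⟩ := hsurj (m - D.incl 1 • m) (by rw [smul_sub, hm, sub_self])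
      refine ⟨⟨(⟨D.incl 1 • m, hm⟩, ⟨m', ?_⟩), Subtype.ext h1⟩, ?_⟩
      · change D.incl 1 • m' = m'
        rw [← h1, ← mul_smul, D.one_mul_incl]
      · rw [hε]
        change D.incl 1 • m + D.x • m' = m
        rw [h2]
        abel
  have := (D.hasProjectiveDimensionLE_ind_iff d (D.Res M)).2 hd
  exact hasProjectiveDimensionLT_of_iso (LinearEquiv.ofBijective ε hb).toModuleIso (d + 1)

lemma hasProjectiveDimensionLE_of_cover {P M : Type u} [AddCommGroup P] [Module R P]
    [Module.Projective R P] [AddCommGroup M] [Module R M] {d : ℕ}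
    (hd : ∀ N : ModuleCat.{u} S, HasProjectiveDimensionLE N d)
    {φ : P →ₗ[R] M} (hφ : Function.Surjective φ)
    (hinj : ∀ p : P, D.incl D.f • p = p → D.x • p = 0 → p = 0)
    (hsurj : ∀ p : P, φ p = 0 → D.incl 1 • p = 0 →
      ∃ q, φ q = 0 ∧ D.incl D.f • q = q ∧ D.x • q = p) :
    HasProjectiveDimensionLE (ModuleCat.of R M) (d + 1) := by
  refine ((LinearMap.shortExact_shortComplexKer hφ).hasProjectiveDimensionLT_X₃_iff d
    ((IsProjective.iff_projective P).1 inferInstance)).2 ?_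
  refine D.hasProjectiveDimensionLE_of_bijective (M := LinearMap.ker φ)
    (fun m h1 h2 => Subtype.ext (hinj _ (congrArg Subtype.val h1) (congrArg Subtype.val h2)))
    (fun m h1 => ?_) (hd _)
  obtain ⟨q, h2, h3, h4⟩ := hsurj m.1 m.2 (congrArg Subtype.val h1)
  exact ⟨⟨q, h2⟩, Subtype.ext h3, Subtype.ext h4⟩

/-- The hypothesis `hrad` says that `(1 - e) R (1 - e)` consists of scalars modulo `x R`. Hence a
cover can be chosen minimal at the vertex of `1 - e`, and the `(1 - e)`-part of its kernel lies in
`x` times the cover. -/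
lemma hasProjectiveDimensionLE_of_injective {K : Type u} [Field K] [Algebra K R]
    (hrad : ∀ r, ∃ (c : K) (r' : R),
      (1 - D.incl 1) * r * (1 - D.incl 1) = c • (1 - D.incl 1) + D.x * r')
    {d : ℕ} (hd : ∀ N : ModuleCat.{u} S, HasProjectiveDimensionLE N d)
    {M : Type u} [AddCommGroup M] [Module R M] [Module K M] [IsScalarTower K R M]
    (hinj : ∀ m : M, D.incl D.f • m = m → D.x • m = 0 → m = 0) :
    HasProjectiveDimensionLE (ModuleCat.of R M) (d + 1) := by
  set g : R := 1 - D.incl 1 with hg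
  have hee : D.incl 1 * D.incl 1 = D.incl 1 := D.incl_mul_one 1
  have hgg : g * g = g := by rw [hg, mul_sub, sub_mul, sub_mul, hee]; simp
  -- `M / (x M + e M)` measures the generators needed at the removed vertex.
  let X : Submodule K M := LinearMap.range (Algebra.lsmul K K M D.x) ⊔
    LinearMap.range (Algebra.lsmul K K M (D.incl 1))
  have hX : ∀ m : M, m ∈ X ↔ ∃ a b : M, D.x • a + D.incl 1 • b = m := fun m => by
    simp [X, Submodule.mem_sup]
  obtain ⟨Y, hY⟩ := Submodule.exists_isCompl X
  let b := Module.Basis.ofVectorSpace K Y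
  let B := Module.Basis.ofVectorSpaceIndex K Y
  -- One summand `R (1 - e)` for each basis vector of the complement `Y` of `X`, and one summand `R
  -- e` for every element of `M`: no minimality is needed away from the removed vertex.
  let u : B ⊕ M → R := Sum.elim (fun _ => g) (fun _ => D.incl 1)
  let w : B ⊕ M → M := Sum.elim (fun i => g • (b i : M)) id
  have hu : ∀ j, u j * u j = u j := by
    rintro (i | m)
    · exact hgg
    · exact hee
  let φ : leftIdealSum u →ₗ[R] M := (Finsupp.linearCombination R w).comp (leftIdealSum u).subtype
  have hφs : ∀ (j : B ⊕ M) (r : R) (h : r * u j = r),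
      φ ⟨Finsupp.single j r, single_mem_leftIdealSum h⟩ = r • w j := fun j r h => by
    change Finsupp.linearCombination R w (Finsupp.single j r) = _
    rw [Finsupp.linearCombination_single]
  have hφe : ∀ m : M, D.incl 1 • m ∈ LinearMap.range φ := fun m => ⟨_, hφs (Sum.inr m) _ hee⟩
  have hφx : ∀ m : M, D.x • m ∈ LinearMap.range φ := fun m => by
    have h := (LinearMap.range φ).smul_mem D.x (hφe m)
    rwa [← mul_smul, D.x_mul_one] at h
  have hdec : ∀ m : M, g • m + D.incl 1 • m = m := fun m => by
    rw [hg, sub_smul, one_smul, sub_add_cancel]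
  have hφX : ∀ m ∈ X, m ∈ LinearMap.range φ := fun m hm => by
    obtain ⟨p, q, rfl⟩ := (hX m).1 hm
    exact add_mem (hφx p) (hφe q)
  have hφb : ∀ i, (b i : M) ∈ LinearMap.range φ := fun i => by
    rw [← hdec (b i : M)]
    refine add_mem ⟨_, (hφs (Sum.inl i) g hgg).trans ?_⟩ (hφe _)
    change g • g • (b i : M) = _
    rw [← mul_smul, hgg]
  have hsurj : Function.Surjective φ := by
    rw [← LinearMap.range_eq_top, eq_top_iff]
    intro m _
    have hm : m ∈ X ⊔ Y := by rw [hY.sup_eq_top]; trivial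
    obtain ⟨m₁, h₁, m₂, h₂, rfl⟩ := Submodule.mem_sup.1 hm
    refine add_mem (hφX _ h₁) ?_
    have h3 := congrArg Subtype.val (b.linearCombination_repr ⟨m₂, h₂⟩)
    change _ = m₂ at h3
    rw [← h3, Finsupp.linearCombination_apply, Finsupp.sum, AddSubmonoidClass.coe_finsetSum]
    refine sum_mem fun i _ => ?_
    rw [Submodule.coe_smul, ← algebraMap_smul R]
    exact Submodule.smul_mem _ _ (hφb i)
  let s : (B →₀ K) → (B ⊕ M →₀ R) := fun c =>
    c.sum fun i a => Finsupp.single (Sum.inl i) (algebraMap K R a * g)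
  have hs_add : ∀ c c', s (c + c') = s c + s c' := fun c c' => by
    refine Finsupp.sum_add_index' (fun i => by simp) fun i a a' => ?_
    rw [map_add, add_mul, Finsupp.single_add]
  -- The `(1 - e)`-part of the cover is the scalar combinations of its generators `1 - e` plus `x`
  -- times its `f`-part: `hrad` handles the summands `R (1 - e)`, `exists_mul` the summands `R e`.
  have hcover : ∀ p : B ⊕ M →₀ R, ∃ (c : B →₀ K) (q : B ⊕ M →₀ R), q ∈ leftIdealSum u ∧
      D.incl D.f • q = q ∧ g • Finsupp.linearCombination R (fun j => Finsupp.single j (u j)) p =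
        s c + D.x • q := by
    intro p
    induction p using Finsupp.induction_linear with
    | zero => exact ⟨0, 0, zero_mem _, smul_zero _, by simp [s]⟩
    | add p p' hp hp' =>
      obtain ⟨c, q, h1, h2, h3⟩ := hp
      obtain ⟨c', q', h1', h2', h3'⟩ := hp'
      refine ⟨c + c', q + q', add_mem h1 h1', by rw [smul_add, h2, h2'], ?_⟩
      rw [map_add, smul_add, h3, h3', hs_add, smul_add]
      abel
    | single j r =>
      have hff : D.incl D.f * D.incl D.f = D.incl D.f := by rw [← D.incl_mul, D.f_mul_f]
      rw [Finsupp.linearCombination_single, Finsupp.smul_single, Finsupp.smul_single]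
      obtain i | m := j
      · obtain ⟨a, r', h⟩ := hrad r
        refine ⟨Finsupp.single i a, Finsupp.single (Sum.inl i) (D.incl D.f * r' * g),
          single_mem_leftIdealSum ?_, ?_, ?_⟩
        · change _ * g = _
          rw [mul_assoc, hgg]
        · rw [Finsupp.smul_single, smul_eq_mul, ← mul_assoc, ← mul_assoc, hff]
        · simp only [s]
          rw [Finsupp.sum_single_index (by simp), Finsupp.smul_single, ← Finsupp.single_add]
          congr 1
          simp only [smul_eq_mul, u, Sum.elim_inl]
          have h' := congrArg (· * g) h
          simp only [add_mul, mul_assoc, hgg, smul_mul_assoc] at h'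
          rw [h', Algebra.smul_def, mul_assoc (D.incl D.f), ← mul_assoc D.x (D.incl D.f), D.x_mul_f]
      · obtain ⟨r', h⟩ := D.exists_mul r
        refine ⟨0, Finsupp.single (Sum.inr m) (D.incl D.f * r' * D.incl 1),
          single_mem_leftIdealSum ?_, ?_, ?_⟩
        · change _ * D.incl 1 = _
          rw [mul_assoc, hee]
        · rw [Finsupp.smul_single, smul_eq_mul, ← mul_assoc, ← mul_assoc, hff]
        · have h' := congrArg (· * D.incl 1) h
          simp only [mul_assoc, hee] at h'
          simp only [s, Finsupp.sum_zero_index, zero_add]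
          rw [Finsupp.smul_single]
          congr 1
          simp only [smul_eq_mul, u, Sum.elim_inr]
          rw [h', mul_assoc (D.incl D.f), ← mul_assoc D.x (D.incl D.f), D.x_mul_f]
  -- Minimality: modulo `e M ≤ X` the generators map to the basis of `Y`, which meets `X` trivially.
  have hs_ind : ∀ c, Finsupp.linearCombination R w (s c) ∈ X → c = 0 := by
    intro c hc
    have h1 : Finsupp.linearCombination R w (s c) +
        D.incl 1 • (Finsupp.linearCombination K b c : M) = Finsupp.linearCombination K b c := by
      simp only [s]
      rw [map_finsuppSum, Finsupp.linearCombination_apply, Finsupp.sum, Finsupp.sum,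
        AddSubmonoidClass.coe_finsetSum, Finset.smul_sum, ← Finset.sum_add_distrib]
      refine Finset.sum_congr rfl fun i _ => ?_
      rw [Finsupp.linearCombination_single, Submodule.coe_smul]
      change (algebraMap K R (c i) * g) • g • (b i : M) + _ = _
      rw [← mul_smul, mul_assoc, hgg, mul_smul, algebraMap_smul, smul_comm (D.incl 1), ← smul_add,
        hdec]
    have h2 : (Finsupp.linearCombination K b c : M) ∈ X := by
      rw [← h1]
      exact add_mem hc ((hX _).2 ⟨0, _, by rw [smul_zero, zero_add]⟩)
    have h3 := Submodule.disjoint_def.1 hY.disjoint _ h2 (Submodule.coe_mem _)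
    exact (linearIndependent_iff.1 b.linearIndependent) c (Subtype.ext h3)
  have hP : Module.Projective R (leftIdealSum u) := projective_leftIdealSum hu
  refine D.hasProjectiveDimensionLE_of_cover (P := leftIdealSum u) hd hsurj
    (fun m h1 h2 => ?_) (fun m hm h1 => ?_)
  · refine Subtype.ext (Finsupp.ext fun j => ?_)
    have h1' := congrArg (fun z => z.1 j) h1
    have h2' := congrArg (fun z => z.1 j) h2
    exact h1'.symm.trans (D.cancel _ h2')
  · obtain ⟨c, q, hq, hfq, h⟩ := hcover m.1
    have h1' : D.incl 1 • m.1 = 0 := congrArg Subtype.val h1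
    rw [linearCombination_single_eq_self m.2, hg, sub_smul, one_smul, h1', sub_zero] at h
    have hm : Finsupp.linearCombination R w m.1 = 0 := hm
    have hc : c = 0 := by
      refine hs_ind c ((hX _).2 ⟨-Finsupp.linearCombination R w q, 0, ?_⟩)
      rw [h, map_add, map_smul] at hm
      rw [smul_neg, smul_zero, add_zero, neg_eq_iff_add_eq_zero, add_comm, hm]
    subst hc
    have hs0 : s 0 = 0 := Finsupp.sum_zero_index
    rw [hs0, zero_add] at h
    -- The kernel element is now `x q`; injectivity of `x` on `f M` puts `q` itself in the kernel.
    have hq0 : Finsupp.linearCombination R w q = 0 := by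
      refine hinj _ (by rw [← map_smul, hfq]) ?_
      rw [← map_smul, ← h, hm]
    exact ⟨⟨q, hq⟩, hq0, Subtype.ext hfq, Subtype.ext h.symm⟩

/-- The kernel of a free cover lies in a free module, where `cancel`, applied coordinatewise, gives
the injectivity required of a first syzygy. -/
lemma hasProjectiveDimensionLE_add_two {K : Type u} [Field K] [Algebra K R]
    (hrad : ∀ r, ∃ (c : K) (r' : R),
      (1 - D.incl 1) * r * (1 - D.incl 1) = c • (1 - D.incl 1) + D.x * r')
    {d : ℕ} (hd : ∀ N : ModuleCat.{u} S, HasProjectiveDimensionLE N d) (M : ModuleCat.{u} R) :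
    HasProjectiveDimensionLE M (d + 2) := by
  let π : (M →₀ R) →ₗ[R] M := Finsupp.linearCombination R id
  have hπ : Function.Surjective π := Finsupp.linearCombination_id_surjective R M
  refine ((LinearMap.shortExact_shortComplexKer hπ).hasProjectiveDimensionLT_X₃_iff (d + 1)
    ((IsProjective.iff_projective _).1 inferInstance)).2 ?_
  refine D.hasProjectiveDimensionLE_of_injective hrad hd fun m h1 h2 => ?_
  refine Subtype.ext (Finsupp.ext fun j => ?_)
  have h1' := congrArg (fun z => z.1 j) h1
  have h2' := congrArg (fun z => z.1 j) h2
  exact h1'.symm.trans (D.cancel _ h2')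

end CornerData

end Nakayama

/-! ### Computing with paths in the path algebra and its monomial quotient -/

namespace Nakayama

universe u

namespace PathAlgebra

variable {K : Type u} [Field K] {n : ℕ}

/-- The coefficient of a path in an element of the path algebra. -/
noncomputable def coeff (p : CyclePath n) : PathAlgebra K n →ₗ[K] K :=
  (Finsupp.lapply p : (CyclePath n →₀ K) →ₗ[K] K)

open Classical in
lemma coeff_ofPath (p q : CyclePath n) :
    coeff p (ofPath K q) = if q = p then 1 else 0 :=
  Finsupp.single_apply

lemma eq_sum (a : PathAlgebra K n) :
    ∃ t : Finset (CyclePath n), a = ∑ p ∈ t, coeff p a • ofPath K p := by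
  have h := Finsupp.sum_single (show CyclePath n →₀ K from a)
  refine ⟨Finsupp.support (show CyclePath n →₀ K from a), h.symm.trans ?_⟩
  exact Finset.sum_congr rfl fun p _ => (Finsupp.smul_single_one p _).symm

lemma induction {P : PathAlgebra K n → Prop} (zero : P 0) (add : ∀ a b, P a → P b → P (a + b))
    (smul : ∀ (c : K) a, P a → P (c • a)) (path : ∀ p, P (ofPath K p)) (a : PathAlgebra K n) :
    P a := by
  obtain ⟨t, h⟩ := eq_sum a
  rw [h]
  exact Finset.sum_induction _ P add zero fun p _ => smul _ _ (path p)

variable [NeZero n]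

lemma ofPath_mul (i j : ZMod n) (l m : ℕ) : ofPath K ⟨i, l⟩ * ofPath K ⟨j, m⟩ =
    if i + l = j then ofPath K ⟨i, l + m⟩ else 0 := by
  rw [ofPath_mul_ofPath]
  unfold pathMul CyclePath.tgt
  congr

lemma coeff_mul_ofPath (a : PathAlgebra K n) (i j : ZMod n) (l m : ℕ) :
    coeff ⟨i, l + m⟩ (a * ofPath K ⟨j, m⟩) = if i + l = j then coeff ⟨i, l⟩ a else 0 := by
  induction a using induction with
  | zero => simp
  | add a b ha hb => rw [add_mul, map_add, ha, hb]; split_ifs <;> simp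
  | smul c a ha => rw [smul_mul_assoc, map_smul, ha]; split_ifs <;> simp
  | path p =>
    obtain ⟨s, k⟩ := p
    rw [ofPath_mul, coeff_ofPath]
    by_cases h : (⟨s, k⟩ : CyclePath n) = ⟨i, l⟩
    · obtain ⟨rfl, rfl⟩ := (CyclePath.mk.injEq _ _ _ _).mp h
      split_ifs <;> simp [coeff_ofPath]
    · have h' : ¬ (⟨s, k + m⟩ : CyclePath n) = ⟨i, l + m⟩ := by
        simpa using h
      rw [if_neg h]
      split_ifs <;> simp [coeff_ofPath, h']

/-- A product of paths has length zero only if both factors do. So this coefficient is a character,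
and its kernel is a two-sided ideal. -/
lemma coeff_zero_mul (a b : PathAlgebra K n) (i : ZMod n) :
    coeff ⟨i, 0⟩ (a * b) = coeff ⟨i, 0⟩ a * coeff ⟨i, 0⟩ b := by
  induction b using induction with
  | zero => simp
  | add b b' h h' => rw [mul_add, map_add, h, h', map_add, mul_add]
  | smul c b h => rw [mul_smul_comm, map_smul, h, map_smul, smul_eq_mul, smul_eq_mul]; ring
  | path q =>
    induction a using induction with
    | zero => simp
    | add b b' h h' => rw [add_mul, map_add, h, h', map_add, add_mul]
    | smul c b h => rw [smul_mul_assoc, map_smul, h, map_smul, smul_eq_mul, smul_eq_mul]; ring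
    | path p =>
      obtain ⟨s, k⟩ := p
      obtain ⟨t, m⟩ := q
      rw [ofPath_mul]
      simp only [coeff_ofPath, CyclePath.mk.injEq]
      have hk : k = 0 → (k : ZMod n) = 0 := fun h => by rw [h, Nat.cast_zero]
      split_ifs with h <;> simp [coeff_ofPath] <;> grind

end PathAlgebra

variable {K : Type u} [Field K] {n : ℕ} [NeZero n] {rels : Finset (CyclePath n)}

open PathAlgebra

lemma toNakayama_eq_zero_iff_mem (a : PathAlgebra K n) :
    toNakayama K rels a = 0 ↔ a ∈ relationIdeal K rels := by
  rw [TwoSidedIdeal.mem_iff, ← RingCon.eq]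
  rfl

lemma toNakayama_smul (c : K) (a : PathAlgebra K n) :
    toNakayama K rels (c • a) = c • toNakayama K rels a := rfl

lemma toNakayama_surjective : Function.Surjective (toNakayama K rels) :=
  RingCon.mk'_surjective _

/-- The ideal of relations is spanned by the paths that it contains. -/
lemma relationIdeal_le_span {a : PathAlgebra K n} (ha : a ∈ relationIdeal K rels) :
    a ∈ Submodule.span K {b | b ∈ relationIdeal K rels ∧ ∃ p, ofPath K p = b} := by
  set J := Submodule.span K {b | b ∈ relationIdeal K rels ∧ ∃ p, ofPath K p = b} with hJ
  -- A product of paths is a path or zero; this is why the span `J` is closed under multiplication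
  -- on both sides.
  have hpath : ∀ (p q : CyclePath n), ofPath K p * ofPath K q ∈ relationIdeal K rels →
      ofPath K p * ofPath K q ∈ J := by
    rintro ⟨i, l⟩ ⟨j, m⟩ h
    rw [ofPath_mul] at h ⊢
    split_ifs at h ⊢
    · exact Submodule.subset_span ⟨h, _, rfl⟩
    · exact zero_mem _
  have hl : ∀ (b a : PathAlgebra K n), a ∈ J → b * a ∈ J := by
    intro b a ha
    induction ha using Submodule.span_induction with
    | zero => rw [mul_zero]; exact zero_mem _
    | add x y _ _ hx hy => rw [mul_add]; exact add_mem hx hy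
    | smul c x _ hx => rw [mul_smul_comm]; exact Submodule.smul_mem _ _ hx
    | mem x hx =>
      obtain ⟨hx, p, rfl⟩ := hx
      induction b using PathAlgebra.induction with
      | zero => rw [zero_mul]; exact zero_mem _
      | add x y hx hy => rw [add_mul]; exact add_mem hx hy
      | smul c x hx => rw [smul_mul_assoc]; exact Submodule.smul_mem _ _ hx
      | path q => exact hpath _ _ (TwoSidedIdeal.mul_mem_left _ _ _ hx)
  have hr : ∀ (a b : PathAlgebra K n), a ∈ J → a * b ∈ J := by
    intro a b ha
    induction ha using Submodule.span_induction with
    | zero => rw [zero_mul]; exact zero_mem _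
    | add x y _ _ hx hy => rw [add_mul]; exact add_mem hx hy
    | smul c x _ hx => rw [smul_mul_assoc]; exact Submodule.smul_mem _ _ hx
    | mem x hx =>
      obtain ⟨hx, p, rfl⟩ := hx
      induction b using PathAlgebra.induction with
      | zero => rw [mul_zero]; exact zero_mem _
      | add x y hx hy => rw [mul_add]; exact add_mem hx hy
      | smul c x hx => rw [mul_smul_comm]; exact Submodule.smul_mem _ _ hx
      | path q => exact hpath _ _ (TwoSidedIdeal.mul_mem_right _ _ _ hx)
  let T : TwoSidedIdeal (PathAlgebra K n) := TwoSidedIdeal.mk' (J : Set (PathAlgebra K n))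
    (zero_mem J) (fun h h' => add_mem h h') (fun h => neg_mem h) (fun h => hl _ _ h)
    (fun h => hr _ _ h)
  have hT : relationIdeal K rels ≤ T := by
    refine TwoSidedIdeal.span_le.2 ?_
    rintro _ ⟨p, hp, rfl⟩
    exact (TwoSidedIdeal.mem_mk' _ _ _ _ _ _ _).2
      (Submodule.subset_span ⟨TwoSidedIdeal.subset_span ⟨p, hp, rfl⟩, p, rfl⟩)
  exact (TwoSidedIdeal.mem_mk' _ _ _ _ _ _ _).1 (hT ha)

/-- Since the ideal is monomial, vanishing in the quotient is tested one path at a time; the nonzero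
path classes are linearly independent. -/
lemma toNakayama_eq_zero_iff (a : PathAlgebra K n) :
    toNakayama K rels a = 0 ↔ ∀ p, coeff p a ≠ 0 → pathClass K rels p = 0 := by
  classical
  constructor
  · intro h
    replace h := relationIdeal_le_span ((toNakayama_eq_zero_iff_mem a).1 h)
    induction h using Submodule.span_induction with
    | zero => simp
    | mem x hx =>
      obtain ⟨hx, q, rfl⟩ := hx
      intro p
      rw [coeff_ofPath]
      intro hq
      obtain rfl : q = p := by by_contra hqp; simp [hqp] at hq
      exact (toNakayama_eq_zero_iff_mem _).2 hx
    | add x y _ _ hx hy =>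
      intro p hp
      by_cases h0 : coeff p x = 0
      · rw [map_add, h0, zero_add] at hp
        exact hy p hp
      · exact hx p h0
    | smul c x _ hx =>
      intro p hp
      rw [map_smul] at hp
      exact hx p (right_ne_zero_of_smul hp)
  · intro h
    obtain ⟨t, ht⟩ := eq_sum a
    rw [ht, map_sum]
    refine Finset.sum_eq_zero fun p _ => ?_
    rw [toNakayama_smul]
    by_cases h0 : coeff p a = 0
    · rw [h0, zero_smul]
    · exact (congrArg _ (h p h0)).trans (smul_zero _)

lemma nakayama_induction {P : NakayamaAlgebra K rels → Prop} (zero : P 0)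
    (add : ∀ a b, P a → P b → P (a + b)) (smul : ∀ (c : K) a, P a → P (c • a))
    (path : ∀ i l, P (pathClass K rels ⟨i, l⟩)) (a : NakayamaAlgebra K rels) : P a := by
  obtain ⟨a, rfl⟩ := toNakayama_surjective a
  induction a using PathAlgebra.induction with
  | zero => rwa [map_zero]
  | add a b ha hb => rw [map_add]; exact add _ _ ha hb
  | smul c a ha => exact smul c _ ha
  | path p => exact path p.1 p.2

lemma pathClass_mul (i j : ZMod n) (l m : ℕ) :
    pathClass K rels ⟨i, l⟩ * pathClass K rels ⟨j, m⟩ =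
      if i + l = j then pathClass K rels ⟨i, l + m⟩ else 0 := by
  unfold pathClass
  rw [← map_mul, ofPath_mul]
  split_ifs
  · rfl
  · exact map_zero _

lemma pathClass_mul_pathClass (i : ZMod n) (l m : ℕ) :
    pathClass K rels ⟨i, l⟩ * pathClass K rels ⟨i + l, m⟩ = pathClass K rels ⟨i, l + m⟩ := by
  rw [pathClass_mul, if_pos rfl]

lemma vertex_mul_pathClass (i : ZMod n) (l : ℕ) :
    pathClass K rels ⟨i, 0⟩ * pathClass K rels ⟨i, l⟩ = pathClass K rels ⟨i, l⟩ := by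
  rw [pathClass_mul, if_pos (by simp), zero_add]

lemma pathClass_mul_vertex (i : ZMod n) (l : ℕ) :
    pathClass K rels ⟨i, l⟩ * pathClass K rels ⟨i + l, 0⟩ = pathClass K rels ⟨i, l⟩ := by
  rw [pathClass_mul, if_pos rfl, add_zero]

lemma vertex_mul_vertex_of_ne {i j : ZMod n} (h : i ≠ j) :
    pathClass K rels ⟨i, 0⟩ * pathClass K rels ⟨j, 0⟩ = 0 := by
  rw [pathClass_mul, if_neg (by simpa using h)]

lemma pathClass_eq_zero_of_le {i : ZMod n} {l m : ℕ} (h : pathClass K rels ⟨i, l⟩ = 0)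
    (hlm : l ≤ m) : pathClass K rels ⟨i, m⟩ = 0 := by
  obtain ⟨k, rfl⟩ := Nat.exists_eq_add_of_le hlm
  rw [← pathClass_mul_pathClass, h, zero_mul]

lemma one_eq_sum_vertices :
    (1 : NakayamaAlgebra K rels) = ∑ i : ZMod n, pathClass K rels ⟨i, 0⟩ := by
  unfold pathClass
  rw [← map_sum, ← one_def, map_one]

lemma exists_vertex_mul_eq (j : ZMod n) (y : NakayamaAlgebra K rels) :
    ∃ (c : K) (w : NakayamaAlgebra K rels), pathClass K rels ⟨j, 0⟩ * y =
      c • pathClass K rels ⟨j, 0⟩ + pathClass K rels ⟨j, 1⟩ * w := by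
  induction y using nakayama_induction with
  | zero => exact ⟨0, 0, by simp⟩
  | add a b ha hb =>
    obtain ⟨c, w, h⟩ := ha
    obtain ⟨c', w', h'⟩ := hb
    exact ⟨c + c', w + w', by rw [mul_add, h, h', add_smul, mul_add]; abel⟩
  | smul c a ha =>
    obtain ⟨c', w, h⟩ := ha
    exact ⟨c * c', c • w, by rw [mul_smul_comm, h, smul_add, mul_smul, mul_smul_comm]⟩
  | path i l =>
    by_cases h : j = i
    · subst h
      obtain _ | l := l
      · exact ⟨1, 0, by rw [vertex_mul_pathClass]; simp⟩
      · refine ⟨0, pathClass K rels ⟨j + (1 : ℕ), l⟩, ?_⟩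
        rw [vertex_mul_pathClass, pathClass_mul_pathClass, zero_smul, zero_add, add_comm]
    · exact ⟨0, 0, by rw [pathClass_mul, if_neg (by simpa using h)]; simp⟩

lemma exists_mul_vertex_eq (j : ZMod n) (y : NakayamaAlgebra K rels) :
    ∃ (c : K) (w : NakayamaAlgebra K rels), y * pathClass K rels ⟨j, 0⟩ =
      c • pathClass K rels ⟨j, 0⟩ + w * pathClass K rels ⟨j - 1, 1⟩ := by
  induction y using nakayama_induction with
  | zero => exact ⟨0, 0, by simp⟩
  | add a b ha hb =>
    obtain ⟨c, w, h⟩ := ha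
    obtain ⟨c', w', h'⟩ := hb
    exact ⟨c + c', w + w', by rw [add_mul, h, h', add_smul, add_mul]; abel⟩
  | smul c a ha =>
    obtain ⟨c', w, h⟩ := ha
    exact ⟨c * c', c • w, by rw [smul_mul_assoc, h, smul_add, mul_smul, smul_mul_assoc]⟩
  | path i l =>
    by_cases h : i + l = j
    · subst h
      obtain _ | l := l
      · exact ⟨1, 0, by rw [pathClass_mul_vertex]; simp⟩
      · refine ⟨0, pathClass K rels ⟨i, l⟩, ?_⟩
        rw [pathClass_mul_vertex, pathClass_mul, if_pos (by push_cast; ring), zero_smul, zero_add]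
    · exact ⟨0, 0, by rw [pathClass_mul, if_neg h]; simp⟩

lemma pathClass_vertex_ne_zero (hlen : ∀ y ∈ rels, 1 ≤ y.len) (i : ZMod n) :
    pathClass K rels ⟨i, 0⟩ ≠ 0 := by
  intro h
  let T : TwoSidedIdeal (PathAlgebra K n) := TwoSidedIdeal.mk'
    {a : PathAlgebra K n | coeff ⟨i, 0⟩ a = 0} (map_zero _)
    (fun {a b} (ha : _ = _) (hb : _ = _) => show _ = _ by rw [map_add, ha, hb, add_zero])
    (fun {a} (ha : _ = _) => show _ = _ by rw [map_neg, ha, neg_zero])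
    (fun {a b} (hb : _ = _) => show _ = _ by rw [coeff_zero_mul, hb, mul_zero])
    (fun {a b} (ha : _ = _) => show _ = _ by rw [coeff_zero_mul, ha, zero_mul])
  have hT : relationIdeal K rels ≤ T := by
    refine TwoSidedIdeal.span_le.2 ?_
    rintro _ ⟨p, hp, rfl⟩
    refine (TwoSidedIdeal.mem_mk' _ _ _ _ _ _ _).2 ?_
    change coeff ⟨i, 0⟩ (ofPath K p) = 0
    rw [coeff_ofPath, if_neg]
    rintro rfl
    exact absurd (hlen _ hp) (by simp)
  have h' : ofPath K (⟨i, 0⟩ : CyclePath n) ∈ {a : PathAlgebra K n | coeff ⟨i, 0⟩ a = 0} :=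
    (TwoSidedIdeal.mem_mk' _ _ _ _ _ _ _).1 (hT ((toNakayama_eq_zero_iff_mem _).1 h))
  rw [Set.mem_ofPred_eq, coeff_ofPath, if_pos rfl] at h'
  exact one_ne_zero h'

lemma exists_pathClass_eq_zero (hne : rels.Nonempty) (i : ZMod n) :
    ∃ l, pathClass K rels ⟨i, l⟩ = 0 := by
  obtain ⟨⟨s, m⟩, hy⟩ := hne
  refine ⟨(s - i).val + m, ?_⟩
  have h : pathClass K rels ⟨s, m⟩ = 0 :=
    (toNakayama_eq_zero_iff_mem _).2 (TwoSidedIdeal.subset_span ⟨_, hy, rfl⟩)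
  rw [← pathClass_mul_pathClass, ZMod.natCast_val, ZMod.cast_id, add_sub_cancel, h, mul_zero]

/-- Appending the arrow at `j` keeps distinct paths ending at `j` distinct. No cancellation can
occur, so the condition `hj` on single paths suffices. -/
lemma mul_vertex_eq_zero {j : ZMod n}
    (hj : ∀ (i : ZMod n) (l : ℕ), i + l = j → pathClass K rels ⟨i, l + 1⟩ = 0 →
      pathClass K rels ⟨i, l⟩ = 0)
    {a : NakayamaAlgebra K rels} (ha : a * pathClass K rels ⟨j, 1⟩ = 0) :
    a * pathClass K rels ⟨j, 0⟩ = 0 := by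
  obtain ⟨a, rfl⟩ := toNakayama_surjective a
  unfold pathClass at ha ⊢
  rw [← map_mul, toNakayama_eq_zero_iff] at ha ⊢
  rintro ⟨i, l⟩ hp
  have h0 := coeff_mul_ofPath a i j l 0
  have h1 := coeff_mul_ofPath a i j l 1
  rw [add_zero] at h0
  rw [h0] at hp
  split_ifs at h0 h1 hp with h
  · exact hj i l h (ha _ (by rwa [h1]))
  · exact absurd rfl hp

end Nakayama

/-! ### The socle of `P_i` and the meaning of a leaf -/

namespace Nakayama

universe u

variable {K : Type u} [Field K] {n : ℕ} [NeZero n] {rels : Finset (CyclePath n)}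

open MulOpposite

lemma mem_proj_iff {i : ZMod n} {a : NakayamaAlgebra K rels} :
    a ∈ proj K rels i ↔ pathClass K rels ⟨i, 0⟩ * a = a := by
  rw [proj, Submodule.mem_span_singleton]
  constructor
  · rintro ⟨r, rfl⟩
    rw [mul_smul_comm, vertex_mul_pathClass]
  · intro h
    exact ⟨op a, h⟩

lemma vertex_mul_mem_proj (i : ZMod n) (a : NakayamaAlgebra K rels) :
    pathClass K rels ⟨i, 0⟩ * a ∈ proj K rels i := by
  rw [mem_proj_iff, ← mul_assoc, vertex_mul_pathClass]

lemma pathClass_mem_proj (i : ZMod n) (l : ℕ) : pathClass K rels ⟨i, l⟩ ∈ proj K rels i :=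
  mem_proj_iff.2 (vertex_mul_pathClass i l)

section Socle

variable {i : ZMod n} {l : ℕ} (h1 : pathClass K rels ⟨i, l + 1⟩ = 0)

include h1

lemma pathClass_mul_mul_eq_zero {k : ℕ} (hk : k ≤ l) (w : NakayamaAlgebra K rels) :
    pathClass K rels ⟨i, k + 1⟩ * w * pathClass K rels ⟨i + k, l - k⟩ = 0 := by
  induction w using nakayama_induction with
  | zero => simp
  | add a b ha hb => rw [mul_add, add_mul, ha, hb, add_zero]
  | smul c a ha => rw [mul_smul_comm, smul_mul_assoc, ha, smul_zero]
  | path s m =>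
    rw [pathClass_mul]
    split_ifs with h
    · rw [pathClass_mul]
      split_ifs
      · exact pathClass_eq_zero_of_le h1 (by omega)
      · rfl
    · rw [zero_mul]

/-- Uniseriality of `P_i`. If the shortest path has nonzero coefficient, multiplying by the path of
length `l - k` kills all longer terms; otherwise pass to paths of length at least `k + 1`. -/
lemma exists_mul_eq_last {t k : ℕ} (hk : k + t = l + 1) (w : NakayamaAlgebra K rels)
    (hw : pathClass K rels ⟨i, k⟩ * w ≠ 0) :
    ∃ b, pathClass K rels ⟨i, k⟩ * w * b = pathClass K rels ⟨i, l⟩ := by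
  induction t generalizing k w with
  | zero =>
    obtain rfl : k = l + 1 := hk
    rw [h1, zero_mul] at hw
    exact absurd rfl hw
  | succ t ih =>
    obtain ⟨c, w', h⟩ := exists_vertex_mul_eq (i + (k : ZMod n)) w
    have h' : pathClass K rels ⟨i, k⟩ * w =
        c • pathClass K rels ⟨i, k⟩ + pathClass K rels ⟨i, k + 1⟩ * w' := by
      rw [← pathClass_mul_vertex, mul_assoc, h, mul_add, mul_smul_comm, pathClass_mul_vertex,
        ← mul_assoc, pathClass_mul_pathClass]
    rw [h'] at hw ⊢
    by_cases hc : c = 0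
    · rw [hc, zero_smul, zero_add] at hw ⊢
      exact ih (by omega) w' hw
    · refine ⟨c⁻¹ • pathClass K rels ⟨i + k, l - k⟩, ?_⟩
      rw [mul_smul_comm, add_mul, pathClass_mul_mul_eq_zero h1 (by omega), add_zero,
        smul_mul_assoc, pathClass_mul_pathClass, smul_smul, inv_mul_cancel₀ hc, one_smul]
      congr 2
      omega

lemma last_mem_of_ne_bot {N : Submodule (NakayamaAlgebra K rels)ᵐᵒᵖ (proj K rels i)}
    (hN : N ≠ ⊥) :
    (⟨pathClass K rels ⟨i, l⟩, pathClass_mem_proj i l⟩ : proj K rels i) ∈ N := by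
  obtain ⟨a, ha, ha0⟩ := Submodule.exists_mem_ne_zero_of_ne_bot hN
  have h2 := mem_proj_iff.1 a.2
  obtain ⟨b, hb⟩ := exists_mul_eq_last (t := l + 1) (k := 0) h1 (by omega) a.1
    (by rw [h2]; exact fun h => ha0 (Subtype.ext h))
  rw [h2] at hb
  have h3 := N.smul_mem (op b) ha
  convert h3
  exact hb.symm

lemma last_mul (y : NakayamaAlgebra K rels) :
    ∃ (c : K) (w : NakayamaAlgebra K rels),
      pathClass K rels ⟨i, l⟩ * y = c • pathClass K rels ⟨i, l⟩ ∧
      pathClass K rels ⟨i + l, 0⟩ * y =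
        c • pathClass K rels ⟨i + l, 0⟩ + pathClass K rels ⟨i + l, 1⟩ * w := by
  obtain ⟨c, w, h⟩ := exists_vertex_mul_eq (i + (l : ZMod n)) y
  refine ⟨c, w, ?_, h⟩
  rw [← pathClass_mul_vertex, mul_assoc, h, mul_add, mul_smul_comm, pathClass_mul_vertex,
    ← mul_assoc, pathClass_mul_pathClass, h1, zero_mul, add_zero]

/-- The last nonzero path lies in every nonzero submodule of `P_i`, so it generates the socle. Left
multiplication by it maps `P_{i+l}` onto the socle with kernel generated by the arrow at `i + l`, so
the socle is `S_{i+l}`; the target `j` satisfies `j - 1 = i + l`. -/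
lemma resolutionQuiver_adj (h0 : pathClass K rels ⟨i, l⟩ ≠ 0) :
    (resolutionQuiver K rels).Adj i (i + l + 1) := by
  let z : proj K rels i := ⟨pathClass K rels ⟨i, l⟩, pathClass_mem_proj i l⟩
  have hz : z ≠ 0 := fun h => h0 (congrArg Subtype.val h)
  let Z : Submodule (NakayamaAlgebra K rels)ᵐᵒᵖ (proj K rels i) := Submodule.span _ {z}
  have hZ : ∀ N : Submodule (NakayamaAlgebra K rels)ᵐᵒᵖ (proj K rels i), N ≠ ⊥ → Z ≤ N :=
    fun N hN => (Submodule.span_singleton_le_iff_mem _ _).2 (last_mem_of_ne_bot h1 hN)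
  have hZ0 : Z ≠ ⊥ := fun h => hz (Submodule.span_singleton_eq_bot.1 h)
  have hatom : IsAtom Z := ⟨hZ0, fun N hN => by
    by_contra h
    exact absurd (hZ N h) hN.not_ge⟩
  have hsoc : socle (NakayamaAlgebra K rels)ᵐᵒᵖ (proj K rels i) = Z := by
    refine le_antisymm (sSup_le fun N hN => ?_) (le_sSup ?_)
    · have hN' := isSimpleModule_iff_isAtom.1 hN
      exact ((hN'.le_iff.1 (hZ N hN'.1)).resolve_left hZ0).ge
    · exact isSimpleModule_iff_isAtom.2 hatom
  let φ : proj K rels (i + l) →ₗ[(NakayamaAlgebra K rels)ᵐᵒᵖ] proj K rels i :=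
    ((LinearMap.mulLeft (NakayamaAlgebra K rels)ᵐᵒᵖ (pathClass K rels ⟨i, l⟩)).comp
      (proj K rels (i + l)).subtype).codRestrict _ fun y => by
        rw [mem_proj_iff, LinearMap.comp_apply, LinearMap.mulLeft_apply, ← mul_assoc,
          vertex_mul_pathClass]
  have hφ : ∀ y, (φ y).1 = pathClass K rels ⟨i, l⟩ * y.1 := fun _ => rfl
  have hrange : LinearMap.range φ = Z := by
    refine le_antisymm ?_ (hZ _ fun h => ?_)
    · rintro _ ⟨y, rfl⟩
      exact Submodule.mem_span_singleton.2 ⟨op y.1, rfl⟩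
    · refine h0 ?_
      have h2 := LinearMap.congr_fun (LinearMap.range_eq_bot.1 h)
        ⟨pathClass K rels ⟨i + l, 0⟩, pathClass_mem_proj _ 0⟩
      rw [← pathClass_mul_vertex]
      exact congrArg Subtype.val h2
  have hker : LinearMap.ker φ = (Submodule.span (NakayamaAlgebra K rels)ᵐᵒᵖ
      {pathClass K rels ⟨i + l, 1⟩}).submoduleOf (proj K rels (i + l)) := by
    ext y
    rw [LinearMap.mem_ker, Submodule.submoduleOf, Submodule.mem_comap,
      Submodule.mem_span_singleton]
    obtain ⟨c, w, h2, h3⟩ := last_mul h1 y.1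
    rw [mem_proj_iff.1 y.2] at h3
    constructor
    · intro hy
      have h4 : c • pathClass K rels ⟨i, l⟩ = 0 := by
        rw [← h2, ← hφ, hy]
        rfl
      have hc : c = 0 := (smul_eq_zero.1 h4).resolve_right h0
      rw [hc, zero_smul, zero_add] at h3
      exact ⟨op w, h3.symm⟩
    · rintro ⟨r, hr⟩
      refine Subtype.ext ?_
      rw [hφ]
      change _ * (r.unop) = y.1 at hr
      rw [← hr, ← mul_assoc, pathClass_mul_pathClass, h1, zero_mul]
      rfl
  have hj : i + l + 1 - 1 = i + (l : ZMod n) := by ring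
  refine ⟨?_⟩
  rw [hj, hsoc]
  exact (((Submodule.quotEquivOfEq _ _ hker.symm).trans φ.quotKerEquivRange).trans
    (LinearEquiv.ofEq _ _ hrange)).symm

end Socle

lemma IsLeaf.pathClass_eq_zero {v : ZMod n} (hv : IsLeaf K rels v) (i : ZMod n) (l : ℕ)
    (hil : i + l = v - 1) (h1 : pathClass K rels ⟨i, l + 1⟩ = 0) : pathClass K rels ⟨i, l⟩ = 0 := by
  by_contra h0
  have h := resolutionQuiver_adj h1 h0
  rw [hil, sub_add_cancel] at h
  exact hv i h

/-- A single vertex cannot be a leaf: every path would end at `v - 1`, and the leaf condition would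
carry the vanishing of some path down to that of `e_v`. -/
lemma IsLeaf.sub_one_ne {v : ZMod n} (hv : IsLeaf K rels v) (hne : rels.Nonempty)
    (hlen : ∀ y ∈ rels, 1 ≤ y.len) : v - 1 ≠ v := by
  intro h
  have h1 : (1 : ZMod n) = 0 := by
    calc (1 : ZMod n) = v - (v - 1) := by ring
      _ = 0 := by rw [h, sub_self]
  have hall : ∀ a : ZMod n, a = 0 := fun a => by rw [← mul_one a, h1, mul_zero]
  obtain ⟨l, hl⟩ := exists_pathClass_eq_zero (K := K) hne v
  induction l with
  | zero => exact pathClass_vertex_ne_zero hlen v hl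
  | succ l ih => exact ih (hv.pathClass_eq_zero v l ((hall _).trans (hall _).symm) hl)

end Nakayama

/-! ### Global dimension, and the reduced algebra as a corner -/

namespace Nakayama

open MulOpposite CategoryTheory

universe u

section GlobalDimension

lemma globalDimension_le_iff {R : Type u} [Ring R] (d : ℕ) :
    globalDimension R ≤ d ↔ ∀ M : ModuleCat.{u} Rᵐᵒᵖ, HasProjectiveDimensionLE M d := by
  simp only [globalDimension, iSup_le_iff, projectiveDimension_le_iff]

lemma globalDimension_ne_bot {R : Type u} [Ring R] [Nontrivial R] : globalDimension R ≠ ⊥ := by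
  intro h
  have h1 : projectiveDimension (ModuleCat.of Rᵐᵒᵖ Rᵐᵒᵖ) = ⊥ :=
    le_bot_iff.1 ((le_iSup (fun M : ModuleCat.{u} Rᵐᵒᵖ => projectiveDimension M) _).trans h.le)
  rw [projectiveDimension_eq_bot_iff, ModuleCat.isZero_iff_subsingleton] at h1
  exact not_subsingleton Rᵐᵒᵖ h1

/-- Nontriviality of `S` excludes the value `⊥`, for which no natural number `d` would give the
sharp bound. -/
lemma globalDimension_le_of_forall {R S : Type u} [Ring R] [Ring S] [Nontrivial S] {k : ℕ}
    (h : ∀ d : ℕ, (∀ M : ModuleCat.{u} Sᵐᵒᵖ, HasProjectiveDimensionLE M d) →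
      ∀ M : ModuleCat.{u} Rᵐᵒᵖ, HasProjectiveDimensionLE M (d + k)) :
    globalDimension R ≤ globalDimension S + k := by
  have hS := globalDimension_ne_bot (R := S)
  generalize hg : globalDimension S = g at hS
  induction g with
  | bot => exact absurd rfl hS
  | coe g =>
    induction g with
    | top => exact le_top
    | coe d => exact (globalDimension_le_iff (d + k)).2 (h d ((globalDimension_le_iff d).1 hg.le))

end GlobalDimension

variable {K : Type u} [Field K] {n : ℕ} [NeZero n] {rels : Finset (CyclePath n)}

lemma linearMap_apply_mul {A B : Type*} [Ring A] [AddCommGroup B] [Module Aᵐᵒᵖ B]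
    (F : A →ₗ[Aᵐᵒᵖ] B) (a : A) : F a = op a • F 1 := by
  rw [← map_smul, op_smul_eq_mul, one_mul]

section Corner

variable (K rels) (v : ZMod n)

/-- The summation map from `⨁ P_i`, `i ≠ v`, to the algebra. -/
noncomputable def sumMap : (∀ i : {i : ZMod n // i ≠ v}, proj K rels i)
    →ₗ[(NakayamaAlgebra K rels)ᵐᵒᵖ] NakayamaAlgebra K rels :=
  ∑ i : {i : ZMod n // i ≠ v}, (proj K rels i).subtype.comp (LinearMap.proj i)

/-- The map from the algebra to `⨁ P_i`, `i ≠ v`, with components `a ↦ e_i a`. -/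
noncomputable def splitMap : NakayamaAlgebra K rels →ₗ[(NakayamaAlgebra K rels)ᵐᵒᵖ]
    (∀ i : {i : ZMod n // i ≠ v}, proj K rels i) :=
  LinearMap.pi fun i =>
    (LinearMap.mulLeft (NakayamaAlgebra K rels)ᵐᵒᵖ (pathClass K rels ⟨i, 0⟩)).codRestrict _
      (vertex_mul_mem_proj i.1)

lemma sumMap_apply (p : ∀ i : {i : ZMod n // i ≠ v}, proj K rels i) :
    sumMap K rels v p = ∑ i, (p i).1 := by
  simp [sumMap]

lemma splitMap_apply (a : NakayamaAlgebra K rels) (i : {i : ZMod n // i ≠ v}) :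
    (splitMap K rels v a i).1 = pathClass K rels ⟨i, 0⟩ * a := rfl

lemma splitMap_sumMap (p : ∀ i : {i : ZMod n // i ≠ v}, proj K rels i) :
    splitMap K rels v (sumMap K rels v p) = p := by
  refine funext fun i => Subtype.ext ?_
  rw [splitMap_apply, sumMap_apply, Finset.mul_sum, Finset.sum_eq_single i]
  · exact mem_proj_iff.1 (p i).2
  · intro j _ hj
    rw [← mem_proj_iff.1 (p j).2, ← mul_assoc,
      vertex_mul_vertex_of_ne fun h => hj (Subtype.ext h.symm), zero_mul]
  · intro h
    exact absurd (Finset.mem_univ _) h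

lemma sumMap_splitMap (a : NakayamaAlgebra K rels) :
    sumMap K rels v (splitMap K rels v a) = (1 - pathClass K rels ⟨v, 0⟩) * a := by
  have h : (1 : NakayamaAlgebra K rels) =
      ∑ i : {i : ZMod n // i ≠ v}, pathClass K rels ⟨i, 0⟩ + pathClass K rels ⟨v, 0⟩ := by
    rw [one_eq_sum_vertices, ← Finset.sum_erase_add _ _ (Finset.mem_univ v)]
    congr 1
    exact Finset.sum_subtype _ (by simp) _
  rw [sumMap_apply, h, add_sub_cancel_right, Finset.sum_mul]
  rfl

/-- The element of the algebra by which an endomorphism of `⨁ P_i`, `i ≠ v`, multiplies. -/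
noncomputable def endToAlgebra : (ReducedAlgebra K rels v)ᵐᵒᵖ →+ (NakayamaAlgebra K rels)ᵐᵒᵖ where
  toFun φ := op (sumMap K rels v (φ.unop (splitMap K rels v 1)))
  map_zero' := by simp
  map_add' φ ψ := by simp

/-- The endomorphism of `⨁ P_i`, `i ≠ v`, given by an element of the algebra. -/
noncomputable def algebraToEnd : (NakayamaAlgebra K rels)ᵐᵒᵖ →+ (ReducedAlgebra K rels v)ᵐᵒᵖ where
  toFun a := op ((splitMap K rels v).comp
    ((LinearMap.mulLeft (NakayamaAlgebra K rels)ᵐᵒᵖ a.unop).comp (sumMap K rels v)))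
  map_zero' := by
    refine unop_injective (LinearMap.ext fun p => ?_)
    simp
  map_add' a b := by
    refine unop_injective (LinearMap.ext fun p => ?_)
    simp [add_mul]

lemma endToAlgebra_apply (φ : (ReducedAlgebra K rels v)ᵐᵒᵖ) :
    (endToAlgebra K rels v φ).unop = sumMap K rels v (φ.unop (splitMap K rels v 1)) := rfl

lemma algebraToEnd_apply (a : (NakayamaAlgebra K rels)ᵐᵒᵖ)
    (p : ∀ i : {i : ZMod n // i ≠ v}, proj K rels i) :
    (algebraToEnd K rels v a).unop p = splitMap K rels v (a.unop * sumMap K rels v p) := rfl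

lemma endToAlgebra_one : endToAlgebra K rels v 1 = op (1 - pathClass K rels ⟨v, 0⟩) := by
  refine unop_injective ?_
  rw [endToAlgebra_apply, unop_one, Module.End.one_apply, sumMap_splitMap, mul_one, unop_op]

lemma endToAlgebra_mul_apply (φ : (ReducedAlgebra K rels v)ᵐᵒᵖ) (a : NakayamaAlgebra K rels) :
    (endToAlgebra K rels v φ).unop * a = sumMap K rels v (φ.unop (splitMap K rels v a)) := by
  have h := linearMap_apply_mul ((sumMap K rels v).comp (φ.unop.comp (splitMap K rels v))) a
  exact h.symm

lemma endToAlgebra_mul (φ ψ : (ReducedAlgebra K rels v)ᵐᵒᵖ) :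
    endToAlgebra K rels v (φ * ψ) = endToAlgebra K rels v φ * endToAlgebra K rels v ψ := by
  refine unop_injective ?_
  rw [MulOpposite.unop_mul, endToAlgebra_mul_apply, endToAlgebra_apply, endToAlgebra_apply,
    splitMap_sumMap]
  rfl

lemma algebraToEnd_endToAlgebra (φ : (ReducedAlgebra K rels v)ᵐᵒᵖ) :
    algebraToEnd K rels v (endToAlgebra K rels v φ) = φ := by
  refine unop_injective (LinearMap.ext fun p => ?_)
  rw [algebraToEnd_apply, endToAlgebra_mul_apply, splitMap_sumMap, splitMap_sumMap]

lemma endToAlgebra_algebraToEnd (a : (NakayamaAlgebra K rels)ᵐᵒᵖ) :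
    endToAlgebra K rels v (algebraToEnd K rels v a) =
      endToAlgebra K rels v 1 * a * endToAlgebra K rels v 1 := by
  refine unop_injective ?_
  rw [endToAlgebra_apply, algebraToEnd_apply, sumMap_splitMap, sumMap_splitMap, endToAlgebra_one,
    MulOpposite.unop_mul, MulOpposite.unop_mul, unop_op, mul_one]

variable {K rels v}

/-- The reduced algebra as a corner of the Nakayama algebra, for a leaf of the resolution
quiver. -/
noncomputable def IsLeaf.cornerData (hv : IsLeaf K rels v) (hne : rels.Nonempty)
    (hlen : ∀ y ∈ rels, 1 ≤ y.len) :
    CornerData (NakayamaAlgebra K rels)ᵐᵒᵖ (ReducedAlgebra K rels v)ᵐᵒᵖ := by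
  have hvv : pathClass K rels ⟨v - 1, 0⟩ * pathClass K rels ⟨v, 0⟩ = 0 :=
    vertex_mul_vertex_of_ne (hv.sub_one_ne hne hlen)
  have hvv' : pathClass K rels ⟨v, 0⟩ * pathClass K rels ⟨v - 1, 0⟩ = 0 :=
    vertex_mul_vertex_of_ne (hv.sub_one_ne hne hlen).symm
  have hx : pathClass K rels ⟨v - 1, 1⟩ * pathClass K rels ⟨v, 0⟩ =
      pathClass K rels ⟨v - 1, 1⟩ := by
    rw [pathClass_mul, if_pos (by push_cast; ring)]
  have hf : endToAlgebra K rels v (algebraToEnd K rels v (op (pathClass K rels ⟨v - 1, 0⟩))) =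
      op (pathClass K rels ⟨v - 1, 0⟩) := by
    refine unop_injective ?_
    rw [endToAlgebra_algebraToEnd, endToAlgebra_one, MulOpposite.unop_mul, MulOpposite.unop_mul,
      unop_op, unop_op,
      mul_sub, mul_one, hvv, sub_zero, sub_mul, one_mul, hvv', sub_zero]
  exact
  { incl := endToAlgebra K rels v
    incl_mul := endToAlgebra_mul K rels v
    compress := algebraToEnd K rels v
    compress_incl := algebraToEnd_endToAlgebra K rels v
    incl_compress := endToAlgebra_algebraToEnd K rels v
    f := algebraToEnd K rels v (op (pathClass K rels ⟨v - 1, 0⟩))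
    f_mul_f := by
      refine Function.LeftInverse.injective (algebraToEnd_endToAlgebra K rels v) ?_
      rw [endToAlgebra_mul, hf, ← op_mul, vertex_mul_pathClass]
    x := op (pathClass K rels ⟨v - 1, 1⟩)
    one_mul_x := by
      rw [endToAlgebra_one, ← op_mul, mul_sub, mul_one, hx, sub_self, op_zero]
    x_mul_f := by
      rw [hf, ← op_mul, vertex_mul_pathClass]
    cancel := fun a ha => by
      -- This is where the leaf condition enters.
      rw [hf]
      refine unop_injective ?_
      exact mul_vertex_eq_zero hv.pathClass_eq_zero (congrArg unop ha)
    exists_mul := fun r => by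
      -- The scalar term is a multiple of `e_v`, which `1 - e_v` kills; what remains ends with the
      -- arrow into `v`.
      obtain ⟨c, w, h⟩ := exists_mul_vertex_eq v r.unop
      refine ⟨op ((1 - pathClass K rels ⟨v, 0⟩) * w), unop_injective ?_⟩
      rw [endToAlgebra_one, MulOpposite.unop_mul, MulOpposite.unop_mul, MulOpposite.unop_sub,
        unop_one, unop_op, sub_sub_cancel, h,
        MulOpposite.unop_mul, unop_op, unop_op, mul_add, mul_smul_comm, sub_mul, one_mul,
        vertex_mul_pathClass, sub_self, smul_zero, zero_add, mul_assoc] }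

lemma IsLeaf.cornerData_incl_one (hv : IsLeaf K rels v) (hne : rels.Nonempty)
    (hlen : ∀ y ∈ rels, 1 ≤ y.len) :
    (hv.cornerData hne hlen).incl 1 = op (1 - pathClass K rels ⟨v, 0⟩) :=
  endToAlgebra_one K rels v

lemma IsLeaf.cornerData_x (hv : IsLeaf K rels v) (hne : rels.Nonempty)
    (hlen : ∀ y ∈ rels, 1 ≤ y.len) :
    (hv.cornerData hne hlen).x = op (pathClass K rels ⟨v - 1, 1⟩) := rfl

lemma IsLeaf.cornerData_compl (hv : IsLeaf K rels v) (hne : rels.Nonempty)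
    (hlen : ∀ y ∈ rels, 1 ≤ y.len) (r : (NakayamaAlgebra K rels)ᵐᵒᵖ) :
    ∃ (c : K) (r' : (NakayamaAlgebra K rels)ᵐᵒᵖ),
      (1 - (hv.cornerData hne hlen).incl 1) * r * (1 - (hv.cornerData hne hlen).incl 1) =
        c • (1 - (hv.cornerData hne hlen).incl 1) + (hv.cornerData hne hlen).x * r' := by
  obtain ⟨c, w, h⟩ := exists_mul_vertex_eq v r.unop
  refine ⟨c, op (pathClass K rels ⟨v, 0⟩ * w), unop_injective ?_⟩
  rw [hv.cornerData_incl_one, hv.cornerData_x, MulOpposite.unop_mul, MulOpposite.unop_mul,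
    MulOpposite.unop_add, MulOpposite.unop_smul, MulOpposite.unop_mul,
    unop_op, unop_op, MulOpposite.unop_sub, unop_one, unop_op, sub_sub_cancel, h, mul_add,
    mul_smul_comm,
    vertex_mul_pathClass, mul_assoc]

lemma nontrivial_reducedAlgebra (hlen : ∀ y ∈ rels, 1 ≤ y.len) (hv : v - 1 ≠ v) :
    Nontrivial (ReducedAlgebra K rels v) := by
  have h : Nontrivial (∀ i : {i : ZMod n // i ≠ v}, proj K rels i) := by
    refine ⟨⟨0, splitMap K rels v (pathClass K rels ⟨v - 1, 0⟩), fun h => ?_⟩⟩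
    have h' := congrArg (fun z => (z ⟨v - 1, hv⟩).1) h
    refine pathClass_vertex_ne_zero (K := K) hlen (v - 1) ?_
    rw [← vertex_mul_pathClass]
    exact h'.symm
  infer_instance

end Corner

end Nakayama

open Nakayama in
/-- If `v` is a leaf of the resolution quiver of a Nakayama algebra `Λ` and `Λ'` is the endomorphism
ring of the sum of the `P_i` with `i ≠ v`, then `gl.dim Λ' ≤ gl.dim Λ ≤ gl.dim Λ' + 2`; in
particular, one of the two global dimensions is finite if and only if the other one is. -/
theorem mainTheorem6 {K : Type*} [Field K] {n : ℕ} [NeZero n] (rels : Finset (CyclePath n))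
    (hne : rels.Nonempty) (hlen : ∀ y ∈ rels, 1 ≤ y.len)
    (v : ZMod n) (hv : IsLeaf K rels v) :
    (globalDimension (ReducedAlgebra K rels v) ≤ globalDimension (NakayamaAlgebra K rels) ∧
      globalDimension (NakayamaAlgebra K rels) ≤ globalDimension (ReducedAlgebra K rels v) + 2) ∧
    (globalDimension (NakayamaAlgebra K rels) < ⊤ ↔
      globalDimension (ReducedAlgebra K rels v) < ⊤) := by
  let D := hv.cornerData hne hlen
  have hΛ' : Nontrivial (ReducedAlgebra K rels v) :=
    nontrivial_reducedAlgebra hlen (hv.sub_one_ne hne hlen)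
  have hΛ : Nontrivial (NakayamaAlgebra K rels) :=
    ⟨⟨_, 0, pathClass_vertex_ne_zero hlen v⟩⟩
  have h1 : globalDimension (ReducedAlgebra K rels v) ≤
      globalDimension (NakayamaAlgebra K rels) := by
    have h := globalDimension_le_of_forall (R := ReducedAlgebra K rels v)
      (S := NakayamaAlgebra K rels) (k := 0) fun d hd N =>
        (D.hasProjectiveDimensionLE_ind_iff d N).1 (hd _)
    rwa [Nat.cast_zero, add_zero] at h
  have h2 : globalDimension (NakayamaAlgebra K rels) ≤
      globalDimension (ReducedAlgebra K rels v) + 2 :=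
    globalDimension_le_of_forall (R := NakayamaAlgebra K rels) (S := ReducedAlgebra K rels v)
      (k := 2) fun d hd M =>
        D.hasProjectiveDimensionLE_add_two (hv.cornerData_compl hne hlen) hd M
  refine ⟨⟨h1, h2⟩, fun h => h1.trans_lt h, fun h => h2.trans_lt ?_⟩
  generalize globalDimension (ReducedAlgebra K rels v) = g at h
  induction g with
  | bot => exact WithBot.bot_lt_coe _
  | coe g =>
    induction g with
    | top => exact absurd h (lt_irrefl _)
    | coe d => exact WithBot.coe_lt_coe.2 (ENat.natCast_lt_top (d + 2))
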